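/- Uniform Young towers. A uniform Young tower $(\Delta,T,\mu)$ consists of the following. $\Delta$ is a metric space with its Borel $\sigma$-algebra, and it is partitioned into sets $\Delta_{\alpha,\ell}$, where $\alpha$ ranges over a countable index set and $0\le \ell\le \phi(\alpha)-1$ for a return time function $\phi$ with positive integer values. The map $T:\Delta\to\Delta$ sends $\Delta_{\alpha,\ell}$ bijectively onto $\Delta_{\alpha,\ell+1}$ if $\ell<\phi(\alpha)-1$, and sends $\Delta_{\alpha,\phi(\alpha)-1}$ bijectively onto $\Delta_0:=\bigcup_\alpha\Delta_{\alpha,0}$. The distance is $d(x,y)=\beta^{s(x,y)}$ for some $0<\beta<1$, where $s(x,y)$ is the first $n\ge 0$ such that $T^nx$ and $T^ny$ are not in the same element of the partition (with $d(x,y)=0$ if there is no such $n$). The measure $\mu$ is a $T$-invariant Borel probability measure for which there is a measurable function $g>0$ (the inverse of the Jacobian) such that $\mu(T(A))=\int_A g^{-1}\,d\mu$ for every measurable $A$ on which $T$ is injective, and there is a constant $C'$ such that $|g(x)/g(y)-1|\le C'\,d(Tx,Ty)$ for all $x,y$ in the same element of the partition. Finally, $\gcd\{\phi(\alpha)\}=1$.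 The tower has exponential tails if there is $c_0>0$ with $\int_{\Delta_0}e^{c_0\phi}\,d\mu<\infty$, where $\phi(x)=\phi(\alpha)$ for $x\in\Delta_{\alpha,0}$. Separately Lipschitz functions. A function $K:\Delta^n\to\mathbb{R}$ is separately Lipschitz with constants $\mathrm{Lip}_0(K),\dots,\mathrm{Lip}_{n-1}(K)\ge 0$ if, for all $0\le i<n$ and all points $x_0,\dots,x_{n-1},x_i'$ of $\Delta$, $$|K(x_0,\dots,x_i,\dots,x_{n-1})-K(x_0,\dots,x_i',\dots,x_{n-1})|\le \mathrm{Lip}_i(K)\,d(x_i,x_i').$$ Theorem. Let $(\Delta,T,\mu)$ be a uniform Young tower with exponential tails. Then it satisfies an exponential concentration inequality: there is $C>0$ such that, for every $n\in\mathbb{N}$ and every separately Lipschitz function $K:\Delta^n\to\mathbb{R}$ with constants $\mathrm{Lip}_i(K)$, the functions $x\mapsto K(x,Tx,\dots,T^{n-1}x)$ and $x\mapsto e^{K(x,Tx,\dots,T^{n-1}x)}$ are $\mu$-integrable and $$\int e^{K(x,Tx,\dots,T^{n-1}x)}\,d\mu(x)\le e^{\int K(x,Tx,\dots,T^{n-1}x)\,d\mu(x)}\;e^{C\sum_{i=0}^{n-1}\mathrm{Lip}_i(K)^2}.$$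 -/

import Mathlib

open MeasureTheory Set
open scoped NNReal ENNReal

/-- The symbolic distance `β ^ s(x, y)`, where the separation time `s(x, y)` is the first `n` such
that `T^n x` and `T^n y` have different labels; it is `0` if the orbits are never separated
(that is, if `s(x, y) = ∞`). -/
noncomputable def symbolicDist {X P : Type*} (T : X → X) (label : X → P) (β : ℝ) (x y : X) : ℝ :=
  open Classical in
  if ∃ n : ℕ, label (T^[n] x) ≠ label (T^[n] y) then
    β ^ sInf {n : ℕ | label (T^[n] x) ≠ label (T^[n] y)}
  else 0

/-- `g` is (a version of) the inverse of the Jacobian of `T` with respect to `μ`: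
`μ (T A) = ∫_A 1 / g dμ` for every measurable set `A` on which `T` is injective. -/
structure IsInverseJacobian {X : Type*} [MeasurableSpace X] (T : X → X) (μ : Measure X)
    (g : X → ℝ) : Prop where
  measurable : Measurable g
  pos : ∀ x, 0 < g x
  measure_image : ∀ A : Set X, MeasurableSet A → InjOn T A →
    μ (T '' A) = ∫⁻ x in A, ENNReal.ofReal (g x)⁻¹ ∂μ

/-- A uniform Young tower on the metric space `Δ`, with its Borel σ-algebra; the columns are indexed
by the countable type `ι`. The partition of `Δ` is given by the two functions `index` and `height`:
the partition element `Δ_{α,ℓ}` is the set of `x` with `index x = α` and `height x = ℓ`,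
where `ℓ < φ α`. -/
structure UniformYoungTower (Δ : Type*) [MetricSpace Δ] [MeasurableSpace Δ] [BorelSpace Δ]
    (ι : Type*) [Countable ι] where
  /-- the dynamics -/
  T : Δ → Δ
  /-- the invariant probability measure -/
  μ : Measure Δ
  /-- the return time, as a function of the column -/
  φ : ι → ℕ
  /-- the column of a point -/
  index : Δ → ι
  /-- the height of a point -/
  height : Δ → ℕ
  /-- the parameter of the distance -/
  β : ℝ
  /-- the inverse of the Jacobian -/
  g : Δ → ℝ
  φ_pos : ∀ α, 0 < φ α
  height_lt : ∀ x, height x < φ (index x)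
  bijOn_up : ∀ α ℓ, ℓ + 1 < φ α →
    BijOn T {x | index x = α ∧ height x = ℓ} {x | index x = α ∧ height x = ℓ + 1}
  bijOn_return : ∀ α ℓ, ℓ + 1 = φ α →
    BijOn T {x | index x = α ∧ height x = ℓ} {x | height x = 0}
  β_pos : 0 < β
  β_lt_one : β < 1
  dist_eq : ∀ x y, dist x y = symbolicDist T (fun z => (index z, height z)) β x y
  isProbabilityMeasure : IsProbabilityMeasure μ
  measurePreserving : MeasurePreserving T μ μ
  isInverseJacobian : IsInverseJacobian T μ g
  distortion : ∃ C : ℝ, ∀ x y, index x = index y → height x = height y →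
    |g x / g y - 1| ≤ C * dist (T x) (T y)
  /-- the greatest common divisor of the return times is `1` -/
  aperiodic : ∀ d : ℕ, (∀ α, d ∣ φ α) → d = 1

/-- The return time `φ` satisfies `∫_{Δ_0} e^{c₀ φ} dμ < ∞` for some `c₀ > 0`, where `Δ_0` is the
set of points at height `0`. -/
def UniformYoungTower.HasExponentialTails {Δ : Type*} [MetricSpace Δ] [MeasurableSpace Δ]
    [BorelSpace Δ] {ι : Type*} [Countable ι] (Y : UniformYoungTower Δ ι) : Prop :=
  ∃ c₀ : ℝ, 0 < c₀ ∧
    IntegrableOn (fun x => Real.exp (c₀ * (Y.φ (Y.index x) : ℝ))) {x | Y.height x = 0} Y.μ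

/-- `K : X^n → ℝ` is separately Lipschitz, with constant `L i` in the `i`-th variable. -/
def IsSeparatelyLipschitz {X : Type*} [MetricSpace X] {n : ℕ} (K : (Fin n → X) → ℝ)
    (L : Fin n → ℝ≥0) : Prop :=
  ∀ (i : Fin n) (x : Fin n → X), LipschitzWith (L i) fun t => K (Function.update x i t)

/-- A Markov chain on `X` that jumps from `x` to `branch α x` with probability `weight α x`, whose
branches contract the distance and which has the Lyapunov function `V`. -/
structure BranchSystem (X ι : Type*) [MetricSpace X] where
  branch : ι → X → X
  weight : ι → X → ℝ
  V : X → ℝ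
  D : X → ℝ
  β : ℝ
  γ : ℝ
  Q : ℝ
  B : ℝ
  weight_nonneg : ∀ α x, 0 ≤ weight α x
  hasSum_weight : ∀ x, HasSum (fun α => weight α x) 1
  β_pos : 0 < β
  β_lt_one : β < 1
  dist_branch : ∀ α x y, dist x y < 1 → dist (branch α x) (branch α y) ≤ β * dist x y
  one_le_V : ∀ x, 1 ≤ V x
  summable_V : ∀ x, Summable fun α => weight α x * V (branch α x)
  γ_pos : 0 < γ
  γ_lt_one : γ < 1
  Q_nonneg : 0 ≤ Q
  drift : ∀ x, ∑' α, weight α x * V (branch α x) ≤ γ * V x + (1 - γ) * Q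
  D_nonneg : ∀ x, 0 ≤ D x
  distortion : ∀ α x y, dist x y < 1 →
    |weight α x - weight α y| ≤ D y * dist x y * weight α y
  D_mul_le : ∀ x, D x * ∑' α, weight α x * V (branch α x) ≤ B

namespace BranchSystem

variable {X ι : Type*} [MetricSpace X] (S : BranchSystem X ι)

/-- The transition operator. -/
noncomputable def op (f : X → ℝ) (x : X) : ℝ := ∑' α, S.weight α x * f (S.branch α x)

/-- Functions dominated by a multiple of `V`. -/
def Dom (f : X → ℝ) : Prop := ∃ M, ∀ x, |f x| ≤ M * S.V x

variable {S}

lemma V_pos (x : X) : 0 < S.V x := zero_lt_one.trans_le (S.one_le_V x)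

lemma Dom.summable {f : X → ℝ} (hf : S.Dom f) (x : X) :
    Summable fun α => S.weight α x * f (S.branch α x) := by
  obtain ⟨M, hM⟩ := hf
  refine Summable.of_norm_bounded ((S.summable_V x).mul_left M) fun α => ?_
  rw [Real.norm_eq_abs, abs_mul, abs_of_nonneg (S.weight_nonneg α x)]
  calc _ ≤ S.weight α x * (M * S.V (S.branch α x)) :=
        mul_le_mul_of_nonneg_left (hM _) (S.weight_nonneg α x)
    _ = _ := by ring

lemma Dom.of_bound {f : X → ℝ} {M : ℝ} (hM : ∀ x, |f x| ≤ M) : S.Dom f :=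
  ⟨M, fun x => (hM x).trans <| le_mul_of_one_le_right ((abs_nonneg _).trans (hM x)) (S.one_le_V x)⟩

lemma dom_const (c : ℝ) : S.Dom fun _ => c := Dom.of_bound fun _ => le_rfl

lemma dom_V : S.Dom S.V := ⟨1, fun x => by rw [abs_of_pos (V_pos x), one_mul]⟩

lemma Dom.add {f g : X → ℝ} (hf : S.Dom f) (hg : S.Dom g) : S.Dom fun x => f x + g x := by
  obtain ⟨M, hM⟩ := hf
  obtain ⟨N, hN⟩ := hg
  exact ⟨M + N, fun x => (abs_add_le _ _).trans (by linarith [hM x, hN x])⟩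

lemma Dom.const_mul {f : X → ℝ} (hf : S.Dom f) (c : ℝ) : S.Dom fun x => c * f x := by
  obtain ⟨M, hM⟩ := hf
  refine ⟨|c| * M, fun x => ?_⟩
  rw [abs_mul, mul_assoc]
  exact mul_le_mul_of_nonneg_left (hM x) (abs_nonneg c)

lemma Dom.sub {f g : X → ℝ} (hf : S.Dom f) (hg : S.Dom g) : S.Dom fun x => f x - g x := by
  simpa [sub_eq_add_neg] using hf.add (hg.const_mul (-1))

lemma op_const (c : ℝ) : S.op (fun _ => c) = fun _ => c := by
  funext x
  simp only [op]
  rw [tsum_mul_right, (S.hasSum_weight x).tsum_eq, one_mul]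

lemma op_add {f g : X → ℝ} (hf : S.Dom f) (hg : S.Dom g) :
    S.op (fun x => f x + g x) = fun x => S.op f x + S.op g x := by
  funext x
  simp only [op, mul_add]
  exact (hf.summable x).tsum_add (hg.summable x)

lemma op_const_mul (f : X → ℝ) (c : ℝ) : S.op (fun x => c * f x) = fun x => c * S.op f x := by
  funext x
  simp only [op, ← tsum_mul_left]
  exact tsum_congr fun α => by ring

lemma op_sub {f g : X → ℝ} (hf : S.Dom f) (hg : S.Dom g) :
    S.op (fun x => f x - g x) = fun x => S.op f x - S.op g x := by
  funext x
  simp only [op, mul_sub]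
  exact (hf.summable x).tsum_sub (hg.summable x)

lemma op_le_op {f g : X → ℝ} (hf : S.Dom f) (hg : S.Dom g) {x : X}
    (h : ∀ α, f (S.branch α x) ≤ g (S.branch α x)) : S.op f x ≤ S.op g x :=
  (hf.summable x).tsum_le_tsum
    (fun α => mul_le_mul_of_nonneg_left (h α) (S.weight_nonneg α x)) (hg.summable x)

lemma Dom.op {f : X → ℝ} (hf : S.Dom f) : S.Dom (S.op f) := by
  have hf' := hf
  obtain ⟨M, hM⟩ := hf
  have hM0 : ∀ x : X, 0 ≤ M := fun x => by
    have := (abs_nonneg _).trans (hM x)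
    exact nonneg_of_mul_nonneg_left this (V_pos x)
  refine ⟨M * (1 + S.Q), fun x => ?_⟩
  have hV : S.op S.V x ≤ (1 + S.Q) * S.V x := by
    have h1 := S.drift x
    have h2 := S.one_le_V x
    have h3 := S.γ_lt_one
    have h4 := S.γ_pos
    have h5 := S.Q_nonneg
    have : S.γ * S.V x ≤ 1 * S.V x := by gcongr
    have : (1 - S.γ) * S.Q ≤ 1 * (S.Q * S.V x) := by
      apply mul_le_mul (by linarith) (le_mul_of_one_le_right h5 h2) h5 zero_le_one
    rw [BranchSystem.op]
    linarith
  have key : |S.op f x| ≤ M * S.op S.V x := by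
    rw [abs_le]
    have h1 := congrFun (S.op_const_mul S.V M) x
    have h2 := congrFun (S.op_const_mul S.V (-M)) x
    constructor
    · have := op_le_op (x := x) (dom_V.const_mul (-M)) hf' fun α => by
        linarith [neg_le_of_abs_le (hM (S.branch α x))]
      rw [h2] at this
      linarith
    · have := op_le_op (x := x) hf' (dom_V.const_mul M) fun α => le_of_abs_le (hM (S.branch α x))
      rwa [h1] at this
  calc _ ≤ _ := key
    _ ≤ M * ((1 + S.Q) * S.V x) := mul_le_mul_of_nonneg_left hV (hM0 x)
    _ = _ := by ring

lemma Dom.iterate {f : X → ℝ} (hf : S.Dom f) (m : ℕ) : S.Dom (S.op^[m] f) := by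
  induction m generalizing f with
  | zero => exact hf
  | succ m ih => exact ih hf.op

lemma iterate_const (c : ℝ) (m : ℕ) : S.op^[m] (fun _ => c) = fun _ => c := by
  induction m with
  | zero => rfl
  | succ m ih => rw [Function.iterate_succ_apply, op_const, ih]

lemma iterate_add {f g : X → ℝ} (hf : S.Dom f) (hg : S.Dom g) (m : ℕ) :
    S.op^[m] (fun x => f x + g x) = fun x => S.op^[m] f x + S.op^[m] g x := by
  induction m generalizing f g with
  | zero => rfl
  | succ m ih => simp only [Function.iterate_succ_apply, op_add hf hg, ih hf.op hg.op]

lemma iterate_const_mul (f : X → ℝ) (c : ℝ) (m : ℕ) :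
    S.op^[m] (fun x => c * f x) = fun x => c * S.op^[m] f x := by
  induction m generalizing f with
  | zero => rfl
  | succ m ih => simp only [Function.iterate_succ_apply, op_const_mul, ih]

lemma iterate_sub {f g : X → ℝ} (hf : S.Dom f) (hg : S.Dom g) (m : ℕ) :
    S.op^[m] (fun x => f x - g x) = fun x => S.op^[m] f x - S.op^[m] g x := by
  induction m generalizing f g with
  | zero => rfl
  | succ m ih => simp only [Function.iterate_succ_apply, op_sub hf hg, ih hf.op hg.op]

lemma iterate_le_iterate {f g : X → ℝ} (hf : S.Dom f) (hg : S.Dom g) (h : ∀ x, f x ≤ g x) (m : ℕ)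
    (x : X) : S.op^[m] f x ≤ S.op^[m] g x := by
  induction m generalizing f g with
  | zero => exact h x
  | succ m ih => exact ih hf.op hg.op fun y => op_le_op hf hg fun α => h _

lemma abs_iterate_sub_const_le {f g : X → ℝ} {c : ℝ} (hf : S.Dom f) (hg : S.Dom g)
    (h : ∀ x, |f x - c| ≤ g x) (m : ℕ) (x : X) : |S.op^[m] f x - c| ≤ S.op^[m] g x := by
  have h1 := iterate_sub hf (S.dom_const c) m
  have h2 := iterate_le_iterate (hf.sub (S.dom_const c)) hg (fun y => le_of_abs_le (h y)) m x
  have h3 := iterate_le_iterate (hg.const_mul (-1)) (hf.sub (S.dom_const c))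
    (fun y => by linarith [neg_le_of_abs_le (h y)]) m x
  rw [iterate_const_mul] at h3
  rw [h1, iterate_const] at h2 h3
  exact abs_le.2 ⟨by linarith, h2⟩

lemma abs_iterate_le {f : X → ℝ} {M : ℝ} (h : ∀ x, |f x| ≤ M) (m : ℕ) (x : X) :
    |S.op^[m] f x| ≤ M := by
  have := abs_iterate_sub_const_le (c := 0) (Dom.of_bound h) (S.dom_const M)
    (fun x => by simpa using h x) m x
  rwa [iterate_const, sub_zero] at this

lemma iterate_V_le (m : ℕ) (x : X) : S.op^[m] S.V x ≤ S.γ ^ m * S.V x + S.Q := by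
  induction m generalizing x with
  | zero => simpa using S.Q_nonneg
  | succ m ih =>
    have h1 := iterate_le_iterate dom_V.op
      ((dom_V.const_mul S.γ).add (S.dom_const ((1 - S.γ) * S.Q))) S.drift m x
    rw [iterate_add (dom_V.const_mul S.γ) (S.dom_const _), iterate_const_mul, iterate_const] at h1
    rw [Function.iterate_succ_apply]
    have h2 := mul_le_mul_of_nonneg_left (ih x) S.γ_pos.le
    calc _ ≤ _ := h1
      _ ≤ _ := by rw [pow_succ]; linarith

lemma iterate_V_le' (m : ℕ) (x : X) : S.op^[m] S.V x ≤ S.V x + S.Q := by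
  refine (iterate_V_le m x).trans ?_
  have := mul_le_mul_of_nonneg_right (pow_le_one₀ (n := m) S.γ_pos.le S.γ_lt_one.le) (S.V_pos x).le
  linarith

lemma weight_mul_le_op {f : X → ℝ} (hf : S.Dom f) (h : ∀ x, 0 ≤ f x) (α : ι) (x : X) :
    S.weight α x * f (S.branch α x) ≤ S.op f x :=
  (hf.summable x).le_tsum α fun α' _ => mul_nonneg (S.weight_nonneg α' x) (h _)

lemma B_nonneg (x : X) : 0 ≤ S.B :=
  le_trans (mul_nonneg (S.D_nonneg x) (tsum_nonneg fun α =>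
    mul_nonneg (S.weight_nonneg α x) (V_pos _).le)) (S.D_mul_le x)

/-- The oscillation of `S.op u` between two nearby points. -/
lemma abs_op_sub_op_le {u : X → ℝ} {a c e : ℝ} (hu : ∀ x, |u x - c| ≤ a * S.V x) {x y : X}
    (hxy : dist x y < 1) (he : ∀ α, |u (S.branch α x) - u (S.branch α y)| ≤ e) :
    |S.op u x - S.op u y| ≤ e + a * S.B * dist x y := by
  have hdom0 : S.Dom fun z => u z - c := ⟨a, hu⟩
  have hdom : S.Dom u := by simpa using hdom0.add (S.dom_const c)
  have hw := fun z => (S.hasSum_weight z).summable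
  have ha : 0 ≤ a := nonneg_of_mul_nonneg_left ((abs_nonneg _).trans (hu x)) (V_pos x)
  have e1 : S.op u x - c = ∑' α, S.weight α x * (u (S.branch α x) - c) := by
    have := congrFun (op_sub hdom (S.dom_const c)) x
    rw [op_const] at this
    exact this.symm
  have e2 : S.op u y - c = ∑' α, S.weight α y * (u (S.branch α y) - c) := by
    have := congrFun (op_sub hdom (S.dom_const c)) y
    rw [op_const] at this
    exact this.symm
  have e3 : S.op u x - S.op u y = ∑' α, (S.weight α x * (u (S.branch α x) - c) -
      S.weight α y * (u (S.branch α y) - c)) := by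
    rw [(hdom0.summable x).tsum_sub (hdom0.summable y), ← e1, ← e2]
    ring
  have hs : HasSum (fun α => S.weight α x * e + a * S.D y * dist x y *
      (S.weight α y * S.V (S.branch α y))) (1 * e + a * S.D y * dist x y *
      ∑' α, S.weight α y * S.V (S.branch α y)) :=
    ((S.hasSum_weight x).mul_right e).add ((S.summable_V y).hasSum.mul_left _)
  rw [e3]
  have hb := tsum_of_norm_bounded hs (f := fun α => S.weight α x * (u (S.branch α x) - c) -
      S.weight α y * (u (S.branch α y) - c)) fun α => ?_
  · rw [Real.norm_eq_abs] at hb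
    refine hb.trans ?_
    have := mul_le_mul_of_nonneg_left (S.D_mul_le y) (mul_nonneg ha (dist_nonneg (x := x) (y := y)))
    nlinarith
  · rw [Real.norm_eq_abs]
    have : S.weight α x * (u (S.branch α x) - c) - S.weight α y * (u (S.branch α y) - c) =
      S.weight α x * (u (S.branch α x) - u (S.branch α y)) +
      (S.weight α x - S.weight α y) * (u (S.branch α y) - c) := by ring
    rw [this]
    refine (abs_add_le _ _).trans (add_le_add ?_ ?_)
    · rw [abs_mul, abs_of_nonneg (S.weight_nonneg α x)]
      exact mul_le_mul_of_nonneg_left (he α) (S.weight_nonneg α x)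
    · rw [abs_mul]
      calc _ ≤ (S.D y * dist x y * S.weight α y) * (a * S.V (S.branch α y)) :=
            mul_le_mul (S.distortion α x y hxy) (hu _) (abs_nonneg _)
              (mul_nonneg (mul_nonneg (S.D_nonneg y) dist_nonneg) (S.weight_nonneg α y))
        _ = _ := by ring

end BranchSystem

namespace BranchSystem

variable {X ι : Type*} [MetricSpace X] {S : BranchSystem X ι}

variable (S) in
/-- Any two points in a sublevel set of `V` can be brought close to each other, simultaneously and
with a probability that is bounded below. -/
def Minorized : Prop := ∀ κ > 0, ∀ R : ℝ, ∃ N ≥ 1, ∃ δ > 0, ∀ x y, S.V x ≤ R → S.V y ≤ R →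
  ∃ x' y', dist x' y' ≤ κ ∧ ∀ f, S.Dom f → (∀ z, 0 ≤ f z) →
    δ * f x' ≤ S.op^[N] f x ∧ δ * f y' ≤ S.op^[N] f y

variable (S) in
/-- The functions with local Lipschitz constant `A * a` whose distance to some constant is at most
`a * (1 + η * V)`. -/
structure InClass (A η a : ℝ) (u : X → ℝ) : Prop where
  lipschitz : ∀ x y, dist x y < 1 → |u x - u y| ≤ A * a * dist x y
  center : ∃ c, ∀ x, |u x - c| ≤ a * (1 + η * S.V x)

lemma exists_center {X : Type*} [Nonempty X] {f F : X → ℝ} (h : ∀ x y, f x - f y ≤ F x + F y) :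
    ∃ c, ∀ x, |f x - c| ≤ F x := by
  have hb : BddAbove (range fun x => f x - F x) := by
    refine ⟨f (Classical.arbitrary X) + F (Classical.arbitrary X), ?_⟩
    rintro _ ⟨x, rfl⟩
    linarith [h x (Classical.arbitrary X)]
  refine ⟨⨆ x, (f x - F x), fun x => abs_le.2 ⟨?_, ?_⟩⟩
  · have : ⨆ y, (f y - F y) ≤ f x + F x := ciSup_le fun y => by linarith [h y x]
    linarith
  · have := le_ciSup hb x
    linarith

lemma dom_affine (a η : ℝ) : S.Dom fun x => a * (1 + η * S.V x) :=
  ((S.dom_const 1).add (dom_V.const_mul η)).const_mul a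

lemma iterate_affine (a η : ℝ) (m : ℕ) (x : X) :
    S.op^[m] (fun x => a * (1 + η * S.V x)) x = a * (1 + η * S.op^[m] S.V x) := by
  rw [iterate_const_mul, iterate_add (S.dom_const 1) (dom_V.const_mul η), iterate_const_mul,
    iterate_const]

lemma dom_of_center {u : X → ℝ} {a η c : ℝ} (h : ∀ x, |u x - c| ≤ a * (1 + η * S.V x)) :
    S.Dom u := by
  obtain ⟨M, hM⟩ := dom_affine (S := S) a η
  have : S.Dom fun x => u x - c := ⟨M, fun x => ((h x).trans (le_abs_self _)).trans (hM x)⟩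
  simpa using this.add (S.dom_const c)

/-- The local part of the contraction. -/
lemma InClass.lipschitz_iterate {A η a : ℝ} {u : X → ℝ} (h : S.InClass A η a u) (ha : 0 ≤ a)
    (hη : 0 ≤ η) (hη1 : η ≤ 1 / 2) (hηQ : η * S.Q ≤ 1 / 2)
    (hA : 2 * S.B ≤ A * ((1 - S.β) / 2)) (hA0 : 0 ≤ A) (m : ℕ) {x y : X} (hxy : dist x y < 1) :
    |S.op^[m + 1] u x - S.op^[m + 1] u y| ≤ A * ((1 + S.β) / 2 * a) * dist x y := by
  obtain ⟨c, hc⟩ := h.center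
  have hdom := dom_of_center hc
  have hβ := S.β_lt_one
  have hβ0 := S.β_pos
  have step : ∀ m, (∀ x y, dist x y < 1 → |S.op^[m] u x - S.op^[m] u y| ≤ A * a * dist x y) →
      ∀ x y, dist x y < 1 →
        |S.op^[m + 1] u x - S.op^[m + 1] u y| ≤ A * ((1 + S.β) / 2 * a) * dist x y := by
    intro m hm x y hxy
    rw [Function.iterate_succ_apply']
    have hcen : ∀ x, |S.op^[m] u x - c| ≤ (2 * a) * S.V x := by
      intro x
      refine (abs_iterate_sub_const_le hdom (dom_affine a η) hc m x).trans ?_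
      rw [iterate_affine, mul_comm 2 a, mul_assoc]
      apply mul_le_mul_of_nonneg_left _ ha
      have h1 := mul_le_mul_of_nonneg_left (iterate_V_le' (S := S) m x) hη
      have h2 := S.one_le_V x
      nlinarith
    refine (abs_op_sub_op_le hcen hxy (e := A * a * (S.β * dist x y)) fun α => ?_).trans ?_
    · have hd := S.dist_branch α x y hxy
      have hd1 : dist (S.branch α x) (S.branch α y) < 1 := by
        nlinarith [dist_nonneg (x := x) (y := y)]
      exact (hm _ _ hd1).trans (mul_le_mul_of_nonneg_left hd (mul_nonneg hA0 ha))
    · have := mul_le_mul_of_nonneg_right hA (mul_nonneg ha (dist_nonneg (x := x) (y := y)))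
      nlinarith
  have all : ∀ m, ∀ x y, dist x y < 1 → |S.op^[m] u x - S.op^[m] u y| ≤ A * a * dist x y := by
    intro m
    induction m with
    | zero => exact h.lipschitz
    | succ m ih =>
      intro x y hxy
      refine (step m ih x y hxy).trans ?_
      apply mul_le_mul_of_nonneg_right _ dist_nonneg
      apply mul_le_mul_of_nonneg_left _ hA0
      nlinarith
  exact step m (all m) x y hxy

/-- Harris' theorem: a power of the operator contracts. -/
theorem exists_contraction [Nonempty X] (hS : S.Minorized) :
    ∃ A η ρ : ℝ, ∃ N : ℕ, 1 ≤ A ∧ 0 < η ∧ η ≤ 1 ∧ 0 < ρ ∧ ρ < 1 ∧ 1 ≤ N ∧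
      ∀ a u, 0 ≤ a → S.InClass A η a u → S.InClass A η (ρ * a) (S.op^[N] u) := by
  have hβ := S.β_lt_one
  have hβ0 := S.β_pos
  have hγ := S.γ_lt_one
  have hγ0 := S.γ_pos
  have hQ := S.Q_nonneg
  have hB := S.B_nonneg (Classical.arbitrary X)
  obtain ⟨A, hA1, hA⟩ : ∃ A : ℝ, 1 ≤ A ∧ 2 * S.B ≤ A * ((1 - S.β) / 2) := by
    refine ⟨4 * S.B / (1 - S.β) + 1, ?_, ?_⟩
    · have : 0 ≤ 4 * S.B / (1 - S.β) := div_nonneg (by linarith) (by linarith)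
      linarith
    · have : (4 * S.B / (1 - S.β) + 1) * ((1 - S.β) / 2) = 2 * S.B + (1 - S.β) / 2 := by
        have : 1 - S.β ≠ 0 := by linarith
        field_simp
        ring
      rw [this]
      linarith
  obtain ⟨R, hR1, hR⟩ : ∃ R : ℝ, 1 ≤ R ∧ 2 * S.Q ≤ (1 - S.γ) / 2 * R := by
    refine ⟨4 * S.Q / (1 - S.γ) + 1, ?_, ?_⟩
    · have : 0 ≤ 4 * S.Q / (1 - S.γ) := div_nonneg (by linarith) (by linarith)
      linarith
    · have : (1 - S.γ) / 2 * (4 * S.Q / (1 - S.γ) + 1) = 2 * S.Q + (1 - S.γ) / 2 := by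
        have : 1 - S.γ ≠ 0 := by linarith
        field_simp
        ring
      rw [this]
      linarith
  obtain ⟨N, hN, δ, hδ, hmin⟩ := hS (1 / (2 * A)) (by positivity) R
  obtain ⟨η, hη0, hη, hη2⟩ : ∃ η : ℝ, 0 < η ∧ η * (R + 2 * S.Q) ≤ δ / 2 ∧
      η * (R + 2 * S.Q) ≤ 1 / 2 := by
    have h0 : 0 < R + 2 * S.Q := by linarith
    refine ⟨min δ 1 / 2 / (R + 2 * S.Q), by positivity, ?_, ?_⟩
    · rw [div_mul_cancel₀ _ h0.ne']
      linarith [min_le_left δ 1]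
    · rw [div_mul_cancel₀ _ h0.ne']
      linarith [min_le_right δ 1]
  have hη1 : η ≤ 1 / 2 := by nlinarith
  have hηQ : η * S.Q ≤ 1 / 2 := by nlinarith
  obtain ⟨ε, hε0, hε1, hε2, hε3, hε4⟩ : ∃ ε : ℝ, 0 < ε ∧ ε ≤ (1 - S.γ) / 4 ∧
      ε ≤ η * R * ((1 - S.γ) / 8) ∧ ε ≤ δ / 2 ∧ ε ≤ (1 - S.β) / 2 := by
    have h1 : 0 < (1 - S.γ) / 4 := by linarith
    have h2 : 0 < η * R * ((1 - S.γ) / 8) := mul_pos (by positivity) (by linarith)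
    have h3 : 0 < (1 - S.β) / 2 := by linarith
    refine ⟨min (min ((1 - S.γ) / 4) (η * R * ((1 - S.γ) / 8))) (min (δ / 2) ((1 - S.β) / 2)),
      by positivity, ?_, ?_, ?_, ?_⟩
    · exact (min_le_left _ _).trans (min_le_left _ _)
    · exact (min_le_left _ _).trans (min_le_right _ _)
    · exact (min_le_right _ _).trans (min_le_left _ _)
    · exact (min_le_right _ _).trans (min_le_right _ _)
  refine ⟨A, η, 1 - ε, N, hA1, hη0, by linarith, by linarith, by linarith, hN, ?_⟩
  intro a u ha hu
  obtain ⟨n, rfl⟩ : ∃ n, N = n + 1 := ⟨N - 1, by omega⟩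
  refine ⟨fun x y hxy => ?_, ?_⟩
  · refine (hu.lipschitz_iterate ha hη0.le hη1 hηQ hA (by linarith) n hxy).trans ?_
    apply mul_le_mul_of_nonneg_right _ dist_nonneg
    apply mul_le_mul_of_nonneg_left _ (by linarith)
    apply mul_le_mul_of_nonneg_right _ ha
    linarith
  apply exists_center
  intro x y
  obtain ⟨c, hc⟩ := hu.center
  have hdom := dom_of_center hc
  have hF := dom_affine (S := S) a η
  have hpos := fun z => S.V_pos z
  by_cases hxy : R ≤ S.V x + S.V y
  · have h1 := fun z => abs_iterate_sub_const_le hdom hF hc (n + 1) z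
    have h2 : ∀ z, S.op^[n + 1] S.V z ≤ S.γ * S.V z + S.Q := by
      intro z
      refine (iterate_V_le (n + 1) z).trans ?_
      have : S.γ ^ (n + 1) ≤ S.γ := pow_le_of_le_one hγ0.le hγ.le (by omega)
      nlinarith [hpos z]
    simp only [iterate_affine] at h1
    have h3 : S.op^[n + 1] u x - S.op^[n + 1] u y ≤
        a * (1 + η * S.op^[n + 1] S.V x) + a * (1 + η * S.op^[n + 1] S.V y) := by
      linarith [le_of_abs_le (h1 x), neg_le_of_abs_le (h1 y)]
    refine h3.trans ?_
    have h4 : (1 + η * S.op^[n + 1] S.V x) + (1 + η * S.op^[n + 1] S.V y) ≤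
        (1 - ε) * ((1 + η * S.V x) + (1 + η * S.V y)) := by
      have h5 := mul_le_mul_of_nonneg_left (add_le_add (h2 x) (h2 y)) hη0.le
      set s := S.V x + S.V y with hs
      have h6 : 2 * S.Q ≤ (1 - S.γ) / 2 * s := hR.trans (by gcongr)
      have h7 : 2 * ε ≤ η * s * ((1 - S.γ) / 4) := by
        have : η * R * ((1 - S.γ) / 8) ≤ η * s * ((1 - S.γ) / 8) := by
          gcongr
        linarith
      have h8 : η * s * ε ≤ η * s * ((1 - S.γ) / 4) := by
        have := hpos x
        have := hpos y
        gcongr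
      have h9 := mul_le_mul_of_nonneg_left h6 hη0.le
      nlinarith
    have := mul_le_mul_of_nonneg_left h4 ha
    linarith
  · push Not at hxy
    obtain ⟨x', y', hd, hx'y'⟩ := hmin x y (by linarith [hpos y]) (by linarith [hpos x])
    have hu0 := hdom.sub (S.dom_const c)
    have h1 := (hx'y' (fun z => a * (1 + η * S.V z) - (u z - c)) (hF.sub hu0) fun z => by
      linarith [le_of_abs_le (hc z)]).1
    have h2 := (hx'y' (fun z => a * (1 + η * S.V z) + (u z - c)) (hF.add hu0) fun z => by
      linarith [neg_le_of_abs_le (hc z)]).2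
    rw [iterate_sub hF hu0, iterate_sub hdom (S.dom_const c), iterate_const] at h1
    rw [iterate_add hF hu0, iterate_sub hdom (S.dom_const c), iterate_const] at h2
    simp only [iterate_affine] at h1 h2
    have hd1 : dist x' y' < 1 := by
      refine hd.trans_lt ?_
      rw [div_lt_one (by linarith)]
      linarith
    have h3 : |u x' - u y'| ≤ a / 2 := by
      refine (hu.lipschitz x' y' hd1).trans ?_
      have := mul_le_mul_of_nonneg_left hd (mul_nonneg (by linarith : 0 ≤ A) ha)
      refine this.trans (le_of_eq ?_)
      field_simp
    have h4 := mul_le_mul_of_nonneg_left (le_of_abs_le h3) hδ.le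
    have h5 := mul_le_mul_of_nonneg_left
      (add_le_add (iterate_V_le' (S := S) (n + 1) x) (iterate_V_le' (S := S) (n + 1) y)) (mul_nonneg ha hη0.le)
    have h6 : 0 ≤ a * η * S.V x' := by have := hpos x'; positivity
    have h7 : 0 ≤ a * η * S.V y' := by have := hpos y'; positivity
    have h8 := mul_nonneg hδ.le h6
    have h9 := mul_nonneg hδ.le h7
    have h10 := mul_le_mul_of_nonneg_left hη ha
    have h11 : a * η * (S.V x + S.V y) ≤ a * η * R := by gcongr
    have h12 : a * ε ≤ a * (δ / 2) := by gcongr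
    have h13 : 0 ≤ (1 - ε) * (a * η * (S.V x + S.V y)) :=
      mul_nonneg (by linarith) (mul_nonneg (by positivity) (by linarith [hpos x, hpos y]))
    have h14 := mul_nonneg ha hδ.le
    nlinarith

/-- Exponential decay of the oscillation of the iterates. -/
theorem exists_decay [Nonempty X] (hS : S.Minorized) :
    ∃ C ρ : ℝ, 0 < C ∧ 0 < ρ ∧ ρ < 1 ∧ ∀ (u : X → ℝ) (a : ℝ), (∀ x, |u x| ≤ a) →
      (∀ x y, dist x y < 1 → |u x - u y| ≤ a * dist x y) →
      ∀ m : ℕ, ∃ c, ∀ x, |S.op^[m] u x - c| ≤ C * a * ρ ^ m * S.V x := by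
  obtain ⟨A, η, ρ, N, hA, hη0, hη1, hρ0, hρ1, hN, hstep⟩ := exists_contraction hS
  have hQ := S.Q_nonneg
  have hN0 : (N : ℝ) ≠ 0 := by positivity
  refine ⟨ρ⁻¹ * (2 + S.Q), ρ ^ (N : ℝ)⁻¹, by positivity, by positivity,
    Real.rpow_lt_one hρ0.le hρ1 (by positivity), fun u a hua hul m => ?_⟩
  have ha : 0 ≤ a := (abs_nonneg _).trans (hua (Classical.arbitrary X))
  have h0 : S.InClass A η a u := by
    refine ⟨fun x y hxy => (hul x y hxy).trans ?_, 0, fun x => ?_⟩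
    · exact mul_le_mul_of_nonneg_right (le_mul_of_one_le_left ha hA) dist_nonneg
    · rw [sub_zero]
      refine (hua x).trans (le_mul_of_one_le_right ha ?_)
      have := mul_pos hη0 (S.V_pos x)
      linarith
  have hk : ∀ k, S.InClass A η (ρ ^ k * a) (S.op^[N * k] u) := by
    intro k
    induction k with
    | zero => simpa using h0
    | succ k ih =>
      have := hstep _ _ (by positivity) ih
      rw [← Function.iterate_add_apply] at this
      rw [pow_succ', mul_assoc, Nat.mul_succ, add_comm]
      exact this
  obtain ⟨c, hc⟩ := (hk (m / N)).center
  refine ⟨c, fun x => ?_⟩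
  have h1 := abs_iterate_sub_const_le (dom_of_center hc) (dom_affine _ η) hc (m % N) x
  rw [← Function.iterate_add_apply, Nat.mod_add_div, iterate_affine] at h1
  refine h1.trans ?_
  have h2 : ρ ^ (m / N) ≤ ρ⁻¹ * (ρ ^ (N : ℝ)⁻¹) ^ m := by
    rw [← Real.rpow_natCast ρ (m / N), ← Real.rpow_natCast _ m, ← Real.rpow_mul hρ0.le,
      ← Real.rpow_neg_one, ← Real.rpow_add hρ0]
    apply Real.rpow_le_rpow_of_exponent_ge hρ0 hρ1.le
    have h3 : (m : ℝ) < N * ((m / N : ℕ) + 1) := by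
      exact_mod_cast Nat.lt_mul_div_succ m (by omega)
    have h4 : (N : ℝ)⁻¹ * m ≤ (m / N : ℕ) + 1 := by
      rw [inv_mul_le_iff₀ (by positivity)]
      exact h3.le
    linarith
  have h3 : 1 + η * S.op^[m % N] S.V x ≤ (2 + S.Q) * S.V x := by
    have h4 := iterate_V_le' (S := S) (m % N) x
    have h5 := S.one_le_V x
    have h6 : η * S.op^[m % N] S.V x ≤ S.V x + S.Q := by
      calc _ ≤ η * (S.V x + S.Q) := by gcongr
        _ ≤ 1 * (S.V x + S.Q) := by gcongr
        _ = _ := one_mul _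
    nlinarith
  have h7 : 0 ≤ (2 + S.Q) * S.V x := by have := S.V_pos x; positivity
  calc _ ≤ (ρ ^ (m / N) * a) * ((2 + S.Q) * S.V x) := by gcongr
    _ ≤ (ρ⁻¹ * (ρ ^ (N : ℝ)⁻¹) ^ m * a) * ((2 + S.Q) * S.V x) := by gcongr
    _ = _ := by ring

end BranchSystem

namespace UniformYoungTower

variable {Δ : Type*} [MetricSpace Δ] [MeasurableSpace Δ] [BorelSpace Δ] {ι : Type*} [Countable ι]
  (Y : UniformYoungTower Δ ι)

lemma dist_le_one (Y : UniformYoungTower Δ ι) (x y : Δ) : dist x y ≤ 1 := by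
  rw [Y.dist_eq, symbolicDist]
  split_ifs
  · exact pow_le_one₀ Y.β_pos.le Y.β_lt_one.le
  · exact zero_le_one

lemma label_eq_of_dist_lt_one {x y : Δ} (h : dist x y < 1) :
    Y.index x = Y.index y ∧ Y.height x = Y.height y := by
  by_contra hne
  have h0 : (Y.index (Y.T^[0] x), Y.height (Y.T^[0] x)) ≠
      (Y.index (Y.T^[0] y), Y.height (Y.T^[0] y)) := by simpa using hne
  rw [Y.dist_eq, symbolicDist, if_pos ⟨0, h0⟩, Nat.sInf_eq_zero.2 (Or.inl h0), pow_zero] at h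
  exact lt_irrefl _ h

open Classical in
lemma dist_eq_mul_dist {x y : Δ} (h : Y.index x = Y.index y) (h' : Y.height x = Y.height y) :
    dist x y = Y.β * dist (Y.T x) (Y.T y) := by
  rw [Y.dist_eq, Y.dist_eq (Y.T x), symbolicDist, symbolicDist]
  set p : ℕ → Prop := fun n => (Y.index (Y.T^[n] x), Y.height (Y.T^[n] x)) ≠
      (Y.index (Y.T^[n] y), Y.height (Y.T^[n] y)) with hp
  have h0 : ¬ p 0 := by simp [hp, h, h']
  have hiff : (∃ n, p n) ↔ ∃ n, p (n + 1) := by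
    constructor
    · rintro ⟨n | n, hn⟩
      · exact absurd hn h0
      · exact ⟨n, hn⟩
    · rintro ⟨n, hn⟩
      exact ⟨n + 1, hn⟩
  change (if ∃ n, p n then Y.β ^ sInf {n | p n} else 0) =
    Y.β * (if ∃ n, p (n + 1) then Y.β ^ sInf {n | p (n + 1)} else 0)
  by_cases hex : ∃ n, p n
  · rw [if_pos hex, if_pos (hiff.1 hex), ← pow_succ']
    congr 1
    refine (Nat.sInf_add (p := p) (n := 1) ?_).symm
    rw [Nat.one_le_iff_ne_zero]
    intro hz
    rcases Nat.sInf_eq_zero.1 hz with hz | hz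
    · exact h0 hz
    · exact (hz ▸ hex.choose_spec : hex.choose ∈ (∅ : Set ℕ)).elim
  · rw [if_neg hex, if_neg (fun h => hex (hiff.2 h)), mul_zero]

lemma dist_T_le (x y : Δ) : dist (Y.T x) (Y.T y) ≤ Y.β⁻¹ * dist x y := by
  rw [← div_eq_inv_mul, le_div_iff₀' Y.β_pos]
  by_cases h : dist x y < 1
  · obtain ⟨h1, h2⟩ := Y.label_eq_of_dist_lt_one h
    exact (Y.dist_eq_mul_dist h1 h2).ge
  · have := Y.dist_le_one (Y.T x) (Y.T y)
    have := mul_le_mul Y.β_lt_one.le this dist_nonneg zero_le_one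
    linarith

lemma label_T {x : Δ} (h : Y.height x + 1 < Y.φ (Y.index x)) :
    Y.index (Y.T x) = Y.index x ∧ Y.height (Y.T x) = Y.height x + 1 :=
  (Y.bijOn_up _ _ h).mapsTo ⟨rfl, rfl⟩

lemma height_T {x : Δ} (h : Y.height x + 1 = Y.φ (Y.index x)) : Y.height (Y.T x) = 0 :=
  (Y.bijOn_return _ _ h).mapsTo ⟨rfl, rfl⟩

lemma height_T_eq_zero_iff {x : Δ} :
    Y.height (Y.T x) = 0 ↔ Y.height x + 1 = Y.φ (Y.index x) := by
  refine ⟨fun h => ?_, Y.height_T⟩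
  by_contra hne
  have := (Y.label_T (lt_of_le_of_ne (Y.height_lt x) hne)).2
  omega

lemma exists_top (α : ι) {x : Δ} (h : Y.height x = 0) :
    ∃ y, (Y.index y = α ∧ Y.height y + 1 = Y.φ α) ∧ Y.T y = x := by
  have hφ := Y.φ_pos α
  obtain ⟨y, hy, rfl⟩ := (Y.bijOn_return α (Y.φ α - 1) (by omega)).surjOn h
  exact ⟨y, ⟨hy.1, by rw [hy.2]; omega⟩, rfl⟩

lemma exists_down {x : Δ} (h : Y.height x ≠ 0) :
    ∃ y, (Y.index y = Y.index x ∧ Y.height y + 1 = Y.height x) ∧ Y.T y = x := by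
  have hx := Y.height_lt x
  obtain ⟨y, hy, rfl⟩ := (Y.bijOn_up (Y.index x) (Y.height x - 1) (by omega)).surjOn
    (show x ∈ _ from ⟨rfl, by omega⟩)
  exact ⟨y, ⟨hy.1, by rw [hy.2]; omega⟩, rfl⟩

open Classical in
/-- The preimage of `x` under `T` at the top of the column `α` if `x` is at height `0`, and
the only preimage otherwise. -/
noncomputable def branch (α : ι) (x : Δ) : Δ :=
  if h : Y.height x = 0 then (Y.exists_top α h).choose else (Y.exists_down h).choose

lemma T_branch (α : ι) (x : Δ) : Y.T (Y.branch α x) = x := by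
  unfold branch
  split_ifs with h
  · exact (Y.exists_top α h).choose_spec.2
  · exact (Y.exists_down h).choose_spec.2

lemma label_branch_of_eq_zero (α : ι) {x : Δ} (h : Y.height x = 0) :
    Y.index (Y.branch α x) = α ∧ Y.height (Y.branch α x) + 1 = Y.φ α := by
  rw [branch, dif_pos h]
  exact (Y.exists_top α h).choose_spec.1

lemma label_branch_of_ne_zero (α : ι) {x : Δ} (h : Y.height x ≠ 0) :
    Y.index (Y.branch α x) = Y.index x ∧ Y.height (Y.branch α x) + 1 = Y.height x := by
  rw [branch, dif_neg h]
  exact (Y.exists_down h).choose_spec.1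

lemma branch_eq_of_ne_zero (α α' : ι) {x : Δ} (h : Y.height x ≠ 0) :
    Y.branch α x = Y.branch α' x := by
  rw [branch, dif_neg h, branch, dif_neg h]

lemma branch_T_of_eq_zero {x : Δ} (h : Y.height (Y.T x) = 0) :
    Y.branch (Y.index x) (Y.T x) = x := by
  have h1 := Y.height_T_eq_zero_iff.1 h
  have h2 := Y.label_branch_of_eq_zero (Y.index x) h
  refine (Y.bijOn_return (Y.index x) (Y.height x) h1).injOn ⟨h2.1, by omega⟩ ⟨rfl, rfl⟩ ?_
  exact Y.T_branch _ _

lemma branch_T_of_ne_zero (α : ι) {x : Δ} (h : Y.height (Y.T x) ≠ 0) :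
    Y.branch α (Y.T x) = x := by
  have h1 : Y.height x + 1 < Y.φ (Y.index x) :=
    lt_of_le_of_ne (Y.height_lt x) fun h1 => h (Y.height_T h1)
  have h2 := Y.label_branch_of_ne_zero α h
  have h3 := Y.label_T h1
  refine (Y.bijOn_up (Y.index x) (Y.height x) h1).injOn ⟨h2.1.trans h3.1, by omega⟩ ⟨rfl, rfl⟩ ?_
  exact Y.T_branch _ _

lemma dist_branch_of_eq_zero (α : ι) {x y : Δ} (hx : Y.height x = 0) (hy : Y.height y = 0) :
    dist (Y.branch α x) (Y.branch α y) = Y.β * dist x y := by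
  have h1 := Y.label_branch_of_eq_zero α hx
  have h2 := Y.label_branch_of_eq_zero α hy
  rw [Y.dist_eq_mul_dist (h1.1.trans h2.1.symm) (by omega), T_branch, T_branch]

lemma dist_branch (α : ι) {x y : Δ} (h : dist x y < 1) :
    dist (Y.branch α x) (Y.branch α y) = Y.β * dist x y := by
  obtain ⟨h1, h2⟩ := Y.label_eq_of_dist_lt_one h
  by_cases h0 : Y.height x = 0
  · exact Y.dist_branch_of_eq_zero α h0 (h2 ▸ h0)
  · have h3 := Y.label_branch_of_ne_zero α h0
    have h4 := Y.label_branch_of_ne_zero α (x := y) (h2 ▸ h0)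
    rw [Y.dist_eq_mul_dist (by rw [h3.1, h4.1, h1]) (by omega), T_branch, T_branch]

lemma continuous_branch (α : ι) : Continuous (Y.branch α) := by
  rw [Metric.continuous_iff]
  intro x ε hε
  refine ⟨min 1 ε, by positivity, fun y hy => ?_⟩
  rw [Y.dist_branch α (hy.trans_le (min_le_left _ _))]
  have := Y.β_lt_one
  calc Y.β * dist y x ≤ 1 * dist y x := by gcongr
    _ < ε := by rw [one_mul]; exact hy.trans_le (min_le_right _ _)

lemma isOpen_setOf_label (p : ι → ℕ → Prop) : IsOpen {x | p (Y.index x) (Y.height x)} := by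
  rw [Metric.isOpen_iff]
  intro x hx
  refine ⟨1, one_pos, fun y hy => ?_⟩
  obtain ⟨h1, h2⟩ := Y.label_eq_of_dist_lt_one (Metric.mem_ball.1 hy)
  simpa [h1, h2] using hx

lemma measurableSet_label (p : ι → ℕ → Prop) :
    MeasurableSet {x | p (Y.index x) (Y.height x)} := (Y.isOpen_setOf_label p).measurableSet

/-- The points at height `0`. -/
def base : Set Δ := {x | Y.height x = 0}

/-- The top level of a column. -/
def top (α : ι) : Set Δ := {x | Y.index x = α ∧ Y.height x + 1 = Y.φ α}

lemma measurableSet_base : MeasurableSet Y.base := Y.measurableSet_label fun _ h => h = 0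

lemma measurableSet_top (α : ι) : MeasurableSet (Y.top α) :=
  Y.measurableSet_label fun a h => a = α ∧ h + 1 = Y.φ α

lemma preimage_base : Y.T ⁻¹' Y.base = ⋃ α, Y.top α := by
  ext x
  simp [base, top, Y.height_T_eq_zero_iff]

lemma disjoint_top : Pairwise (Function.onFun Disjoint Y.top) := by
  intro α α' h
  rw [Function.onFun, Set.disjoint_left]
  rintro x ⟨h1, -⟩ ⟨h2, -⟩
  exact h (h1.symm.trans h2)

lemma exists_iterate_mem_base (x : Δ) : ∃ n, Y.T^[n] x ∈ Y.base := by
  obtain ⟨n, hn⟩ : ∃ n, n + Y.height x + 1 = Y.φ (Y.index x) :=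
    ⟨Y.φ (Y.index x) - Y.height x - 1, by have := Y.height_lt x; omega⟩
  induction n generalizing x with
  | zero => exact ⟨1, Y.height_T (by omega)⟩
  | succ n ih =>
    have h := Y.label_T (x := x) (by omega)
    obtain ⟨m, hm⟩ := ih (Y.T x) (by rw [h.1, h.2]; omega)
    exact ⟨m + 1, hm⟩

lemma measure_base_ne_zero : Y.μ Y.base ≠ 0 := by
  have := Y.isProbabilityMeasure
  intro h
  have h1 : ∀ n, Y.μ (Y.T^[n] ⁻¹' Y.base) = 0 := fun n => by
    rw [(Y.measurePreserving.iterate n).measure_preimage Y.measurableSet_base.nullMeasurableSet, h]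
  have h2 : (univ : Set Δ) ⊆ ⋃ n, Y.T^[n] ⁻¹' Y.base := fun x _ =>
    mem_iUnion.2 (Y.exists_iterate_mem_base x)
  have h3 := measure_mono_null h2 (measure_iUnion_null h1)
  rw [measure_univ] at h3
  exact one_ne_zero h3

lemma measure_level (α : ι) (ℓ : ℕ) (h : ℓ < Y.φ α) :
    Y.μ {x | Y.index x = α ∧ Y.height x = ℓ} = Y.μ {x | Y.index x = α ∧ Y.height x = 0} := by
  induction ℓ with
  | zero => rfl
  | succ ℓ ih =>
    rw [← ih (by omega), ← Y.measurePreserving.measure_preimage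
      (Y.measurableSet_label fun a n => a = α ∧ n = ℓ + 1).nullMeasurableSet]
    congr 1
    ext x
    constructor
    · rintro ⟨h1, h2⟩
      have h3 : Y.height x + 1 < Y.φ (Y.index x) :=
        lt_of_le_of_ne (Y.height_lt x) fun h3 => by have := Y.height_T h3; omega
      have h4 := Y.label_T h3
      exact ⟨h4.1 ▸ h1, by omega⟩
    · rintro ⟨rfl, rfl⟩
      exact Y.label_T h

lemma measure_top (α : ι) : Y.μ (Y.top α) = Y.μ {x | Y.index x = α ∧ Y.height x = 0} := by
  have := Y.φ_pos α
  rw [← Y.measure_level α (Y.φ α - 1) (by omega)]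
  congr 1
  ext x
  simp only [top, mem_ofPred_eq]
  constructor <;> rintro ⟨h1, h2⟩ <;> exact ⟨h1, by omega⟩

lemma g_pos (x : Δ) : 0 < Y.g x := Y.isInverseJacobian.pos x

lemma injOn_top (α : ι) : InjOn Y.T (Y.top α) := by
  rintro x ⟨hx, hx'⟩ y ⟨hy, hy'⟩ h
  exact (Y.bijOn_return α (Y.height x) hx').injOn ⟨hx, rfl⟩ ⟨hy, by omega⟩ h

lemma map_branch (α : ι) : (Y.μ.restrict Y.base).map (Y.branch α) =
    (Y.μ.restrict (Y.top α)).withDensity fun x => ENNReal.ofReal (Y.g x)⁻¹ := by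
  ext s hs
  rw [Measure.map_apply (Y.continuous_branch α).measurable hs, withDensity_apply _ hs,
    Measure.restrict_restrict hs, Measure.restrict_apply ((Y.continuous_branch α).measurable hs),
    ← Y.isInverseJacobian.measure_image _ (hs.inter (Y.measurableSet_top α))
      ((Y.injOn_top α).mono inter_subset_right)]
  congr 1
  ext x
  constructor
  · rintro ⟨h1, h2⟩
    exact ⟨Y.branch α x, ⟨h1, Y.label_branch_of_eq_zero α h2⟩, Y.T_branch α x⟩
  · rintro ⟨y, ⟨h1, rfl, h2⟩, rfl⟩
    refine ⟨?_, Y.height_T h2⟩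
    rwa [mem_preimage, Y.branch_T_of_eq_zero (Y.height_T h2)]

lemma lintegral_branch (α : ι) {f : Δ → ℝ≥0∞} (hf : Measurable f) :
    ∫⁻ x in Y.base, ENNReal.ofReal (Y.g (Y.branch α x)) * f (Y.branch α x) ∂Y.μ =
      ∫⁻ x in Y.top α, f x ∂Y.μ := by
  have hg := Y.isInverseJacobian.measurable
  rw [← lintegral_map (f := fun y => ENNReal.ofReal (Y.g y) * f y) (by fun_prop)
    (Y.continuous_branch α).measurable, map_branch, lintegral_withDensity_eq_lintegral_mul _
    (by fun_prop) (by fun_prop)]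
  refine lintegral_congr fun x => ?_
  rw [Pi.mul_apply, ← mul_assoc, ← ENNReal.ofReal_mul (inv_nonneg.2 (Y.g_pos x).le),
    inv_mul_cancel₀ (Y.g_pos x).ne', ENNReal.ofReal_one, one_mul]

lemma lintegral_tsum_branch {f : Δ → ℝ≥0∞} (hf : Measurable f) :
    ∫⁻ x in Y.base, ∑' α, ENNReal.ofReal (Y.g (Y.branch α x)) * f (Y.branch α x) ∂Y.μ =
      ∫⁻ x in Y.T ⁻¹' Y.base, f x ∂Y.μ := by
  have hg := Y.isInverseJacobian.measurable
  rw [lintegral_tsum, preimage_base, lintegral_iUnion Y.measurableSet_top Y.disjoint_top]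
  · exact tsum_congr fun α => Y.lintegral_branch α hf
  · intro α
    have := (Y.continuous_branch α).measurable
    fun_prop

/-- The Jacobian is normalized. -/
lemma ae_tsum_g_branch :
    ∀ᵐ x ∂(Y.μ.restrict Y.base), ∑' α, ENNReal.ofReal (Y.g (Y.branch α x)) = 1 := by
  have := Y.isProbabilityMeasure
  have hg := Y.isInverseJacobian.measurable
  refine ae_eq_of_forall_setLIntegral_eq_of_sigmaFinite (f := fun x =>
    ∑' α, ENNReal.ofReal (Y.g (Y.branch α x))) (g := fun _ => 1) ?_ measurable_const fun s hs _ => ?_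
  · refine Measurable.tsum fun α => ?_
    have := (Y.continuous_branch α).measurable
    fun_prop
  · have h1 := Y.lintegral_tsum_branch (f := (Y.T ⁻¹' s).indicator 1)
      (measurable_one.indicator (Y.measurePreserving.measurable hs))
    rw [lintegral_indicator_one (Y.measurePreserving.measurable hs),
      Measure.restrict_apply (Y.measurePreserving.measurable hs), ← preimage_inter,
      Y.measurePreserving.measure_preimage (hs.inter Y.measurableSet_base).nullMeasurableSet] at h1
    rw [setLIntegral_const, one_mul, Measure.restrict_apply hs, ← h1, ← lintegral_indicator hs]
    refine lintegral_congr fun x => ?_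
    by_cases hx : x ∈ s
    · simp [hx, indicator, Y.T_branch]
    · simp [hx, indicator, Y.T_branch]

end UniformYoungTower

namespace UniformYoungTower

variable {Δ : Type*} [MetricSpace Δ] [MeasurableSpace Δ] [BorelSpace Δ] {ι : Type*} [Countable ι]
  (Y : UniformYoungTower Δ ι)

lemma base_nonempty : Y.base.Nonempty := nonempty_of_measure_ne_zero Y.measure_base_ne_zero

lemma measureReal_base_pos : 0 < Y.μ.real Y.base := by
  have := Y.isProbabilityMeasure
  exact ENNReal.toReal_pos Y.measure_base_ne_zero (measure_ne_top _ _)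

lemma exists_distortion : ∃ C, 0 ≤ C ∧ ∀ x y, Y.index x = Y.index y → Y.height x = Y.height y →
    |Y.g x - Y.g y| ≤ C * dist (Y.T x) (Y.T y) * Y.g y := by
  obtain ⟨C, hC⟩ := Y.distortion
  refine ⟨max C 0, le_max_right _ _, fun x y h h' => ?_⟩
  have hg := Y.g_pos y
  have h1 : Y.g x - Y.g y = (Y.g x / Y.g y - 1) * Y.g y := by field_simp
  rw [h1, abs_mul, abs_of_pos hg]
  gcongr
  exact (hC x y h h').trans (by gcongr; exact le_max_left _ _)

lemma summable_exp_mul_measureReal_top {c : ℝ}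
    (hc : IntegrableOn (fun x => Real.exp (c * (Y.φ (Y.index x) : ℝ))) {x | Y.height x = 0} Y.μ) :
    Summable fun α => Real.exp (c * (Y.φ α : ℝ)) * Y.μ.real (Y.top α) := by
  have hU : {x | Y.height x = 0} = ⋃ α, {x | Y.index x = α ∧ Y.height x = 0} := by
    ext x
    simp
  rw [hU] at hc
  have hd : Pairwise (Function.onFun Disjoint fun α => {x | Y.index x = α ∧ Y.height x = 0}) := by
    intro α α' h
    rw [Function.onFun, Set.disjoint_left]
    rintro x ⟨h1, -⟩ ⟨h2, -⟩
    exact h (h1.symm.trans h2)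
  have hm : ∀ α, MeasurableSet {x | Y.index x = α ∧ Y.height x = 0} := fun α =>
    Y.measurableSet_label fun a h => a = α ∧ h = 0
  refine (hasSum_integral_iUnion hm hd hc).summable.congr fun α => ?_
  rw [setIntegral_congr_fun (hm α) (g := fun _ => Real.exp (c * (Y.φ α : ℝ)))
    (fun x hx => by simp only [hx.1]), setIntegral_const, Measure.real, Measure.real,
    Y.measure_top, smul_eq_mul, mul_comm]

/-- The sum of the inverse Jacobian over the branches. -/
noncomputable def gSum (x : Δ) : ℝ := ∑' α, Y.g (Y.branch α x)

open Classical in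
/-- The transition probabilities of the backward chain. -/
noncomputable def weight (α : ι) (x : Δ) : ℝ :=
  if Y.height x = 0 then Y.g (Y.branch α x) / Y.gSum x else if α = Y.index x then 1 else 0

variable {Y} {C : ℝ}

lemma g_le_of_label_eq (hC0 : 0 ≤ C)
    (hC : ∀ x y, Y.index x = Y.index y → Y.height x = Y.height y →
      |Y.g x - Y.g y| ≤ C * dist (Y.T x) (Y.T y) * Y.g y)
    {x y : Δ} (h : Y.index x = Y.index y) (h' : Y.height x = Y.height y) :
    Y.g x ≤ (1 + C) * Y.g y := by
  have h1 := le_of_abs_le (hC x y h h')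
  have h2 : C * dist (Y.T x) (Y.T y) * Y.g y ≤ C * 1 * Y.g y := by
    have := (Y.g_pos y).le
    gcongr
    exact Y.dist_le_one _ _
  linarith

lemma g_branch_le_g_branch (hC0 : 0 ≤ C)
    (hC : ∀ x y, Y.index x = Y.index y → Y.height x = Y.height y →
      |Y.g x - Y.g y| ≤ C * dist (Y.T x) (Y.T y) * Y.g y)
    (α : ι) {x y : Δ} (hx : Y.height x = 0) (hy : Y.height y = 0) :
    Y.g (Y.branch α x) ≤ (1 + C) * Y.g (Y.branch α y) := by
  have h1 := Y.label_branch_of_eq_zero α hx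
  have h2 := Y.label_branch_of_eq_zero α hy
  exact g_le_of_label_eq hC0 hC (h1.1.trans h2.1.symm) (by omega)

lemma g_branch_le (hC0 : 0 ≤ C)
    (hC : ∀ x y, Y.index x = Y.index y → Y.height x = Y.height y →
      |Y.g x - Y.g y| ≤ C * dist (Y.T x) (Y.T y) * Y.g y)
    (α : ι) {x : Δ} (hx : Y.height x = 0) :
    Y.g (Y.branch α x) ≤ (1 + C) / Y.μ.real Y.base * Y.μ.real (Y.top α) := by
  have := Y.isProbabilityMeasure
  have hb := Y.measureReal_base_pos
  have hl := Y.label_branch_of_eq_zero α hx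
  have hg := Y.g_pos (Y.branch α x)
  have h1 : Y.μ Y.base = ∫⁻ y in Y.top α, ENNReal.ofReal (Y.g y)⁻¹ ∂Y.μ := by
    have h2 := congrArg (fun ν => ν univ) (Y.map_branch α)
    simpa [Measure.map_apply (Y.continuous_branch α).measurable MeasurableSet.univ] using h2
  have h2 : Y.μ Y.base ≤ ENNReal.ofReal ((1 + C) / Y.g (Y.branch α x)) * Y.μ (Y.top α) := by
    rw [h1, ← setLIntegral_const]
    refine setLIntegral_mono measurable_const fun y hy => ENNReal.ofReal_le_ofReal ?_
    rw [inv_eq_one_div, div_le_div_iff₀ (Y.g_pos y) hg, one_mul]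
    exact g_le_of_label_eq hC0 hC (hl.1.trans hy.1.symm) (by have := hl.2; have := hy.2; omega)
  have h3 : Y.μ.real Y.base ≤ (1 + C) / Y.g (Y.branch α x) * Y.μ.real (Y.top α) := by
    have h4 := ENNReal.toReal_mono (by finiteness) h2
    rwa [ENNReal.toReal_mul, ENNReal.toReal_ofReal (by positivity)] at h4
  rw [div_mul_eq_mul_div, le_div_iff₀ hb]
  rw [div_mul_eq_mul_div, le_div_iff₀ hg] at h3
  linarith

lemma summable_g_branch_mul_exp (hC0 : 0 ≤ C)
    (hC : ∀ x y, Y.index x = Y.index y → Y.height x = Y.height y →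
      |Y.g x - Y.g y| ≤ C * dist (Y.T x) (Y.T y) * Y.g y)
    {c : ℝ} (hc : Summable fun α =>
    Real.exp (c * (Y.φ α : ℝ)) * Y.μ.real (Y.top α)) {x : Δ} (hx : Y.height x = 0) :
    Summable (fun α => Y.g (Y.branch α x) * Real.exp (c * (Y.φ α : ℝ))) ∧
    ∑' α, Y.g (Y.branch α x) * Real.exp (c * (Y.φ α : ℝ)) ≤
      (1 + C) / Y.μ.real Y.base * ∑' α, Real.exp (c * (Y.φ α : ℝ)) * Y.μ.real (Y.top α) := by
  have hle : ∀ α, Y.g (Y.branch α x) * Real.exp (c * (Y.φ α : ℝ)) ≤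
      (1 + C) / Y.μ.real Y.base * (Real.exp (c * (Y.φ α : ℝ)) * Y.μ.real (Y.top α)) := fun α => by
    have := mul_le_mul_of_nonneg_right (g_branch_le hC0 hC α hx) (Real.exp_pos (c * Y.φ α)).le
    linarith
  have hs : Summable (fun α => Y.g (Y.branch α x) * Real.exp (c * (Y.φ α : ℝ))) :=
    Summable.of_nonneg_of_le (fun α => mul_nonneg (Y.g_pos _).le (Real.exp_pos _).le) hle
      (hc.mul_left _)
  refine ⟨hs, ?_⟩
  rw [← tsum_mul_left]
  exact hs.tsum_le_tsum hle (hc.mul_left _)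

lemma weight_of_eq_zero (α : ι) {x : Δ} (hx : Y.height x = 0) :
    Y.weight α x = Y.g (Y.branch α x) / Y.gSum x := by
  rw [weight, if_pos hx]

open Classical in
lemma weight_of_ne_zero (α : ι) {x : Δ} (hx : Y.height x ≠ 0) :
    Y.weight α x = if α = Y.index x then 1 else 0 := by
  rw [weight, if_neg hx]

variable (Y) in
/-- The properties of a system of branches that describes the backward chain of the tower. -/
structure IsAdapted (S : BranchSystem Δ ι) : Prop where
  branch_eq : S.branch = Y.branch
  weight_eq : S.weight = Y.weight
  β_eq : S.β = Y.β
  V_eq : ∃ ε > 0, ∀ x, S.V x = Real.exp (ε * Y.height x)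
  weight_lower : ∀ α, ∃ c > 0, ∀ x, Y.height x = 0 → c ≤ S.weight α x
  cube : ∃ M, ∀ x, Y.height x = 0 →
    Summable (fun α => S.weight α x * S.V (S.branch α x) ^ 3) ∧
      ∑' α, S.weight α x * S.V (S.branch α x) ^ 3 ≤ M

theorem exists_isAdapted (hY : Y.HasExponentialTails) : ∃ S, Y.IsAdapted S := by
  classical
  obtain ⟨c, hc0, hc⟩ := hY
  obtain ⟨C, hC0, hC⟩ := Y.exists_distortion
  have hsum := Y.summable_exp_mul_measureReal_top hc
  set M := (1 + C) / Y.μ.real Y.base * ∑' α, Real.exp (c * (Y.φ α : ℝ)) * Y.μ.real (Y.top α)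
    with hM
  have hge := fun {x : Δ} (hx : Y.height x = 0) => summable_g_branch_mul_exp hC0 hC hsum hx
  obtain ⟨x₀, hx₀⟩ := Y.base_nonempty
  have hx₀ : Y.height x₀ = 0 := hx₀
  have hle1 : ∀ α x, Y.g (Y.branch α x) ≤ Y.g (Y.branch α x) * Real.exp (c * (Y.φ α : ℝ)) :=
    fun α x => le_mul_of_one_le_right (Y.g_pos _).le (Real.one_le_exp (by positivity))
  have hgs : ∀ {x}, Y.height x = 0 → Summable fun α => Y.g (Y.branch α x) := fun {x} hx =>
    Summable.of_nonneg_of_le (fun α => (Y.g_pos _).le) (fun α => hle1 α x) (hge hx).1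
  have hZM : ∀ {x}, Y.height x = 0 → Y.gSum x ≤ M := fun {x} hx =>
    ((hgs hx).tsum_le_tsum (fun α => hle1 α x) (hge hx).1).trans (hge hx).2
  have hC1 : 0 < 1 + C := by linarith
  set z := Y.g (Y.branch (Y.index x₀) x₀) / (1 + C) with hz
  have hz0 : 0 < z := div_pos (Y.g_pos _) hC1
  have hZz : ∀ {x}, Y.height x = 0 → z ≤ Y.gSum x := fun {x} hx => by
    have h1 := g_branch_le_g_branch hC0 hC (Y.index x₀) hx₀ hx
    have h2 : Y.g (Y.branch (Y.index x₀) x) ≤ Y.gSum x :=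
      (hgs hx).le_tsum _ fun α _ => (Y.g_pos _).le
    rw [hz, div_le_iff₀ hC1]
    nlinarith
  have hZ0 : ∀ {x}, Y.height x = 0 → 0 < Y.gSum x := fun hx => hz0.trans_le (hZz hx)
  have hM0 : 0 < M := (hZ0 hx₀).trans_le (hZM hx₀)
  have hwnn : ∀ α x, 0 ≤ Y.weight α x := fun α x => by
    by_cases hx : Y.height x = 0
    · rw [weight_of_eq_zero α hx]
      exact div_nonneg (Y.g_pos _).le (hZ0 hx).le
    · rw [weight_of_ne_zero α hx]
      split_ifs <;> norm_num
  have hws : ∀ x, HasSum (fun α => Y.weight α x) 1 := fun x => by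
    by_cases hx : Y.height x = 0
    · simp only [weight_of_eq_zero _ hx]
      have := (hgs hx).hasSum.div_const (Y.gSum x)
      rwa [← gSum, div_self (hZ0 hx).ne'] at this
    · simp only [weight_of_ne_zero _ hx]
      exact hasSum_ite_eq _ _
  have hbd : ∀ {x} (f : Δ → ℝ), Y.height x = 0 → (∀ y, 0 ≤ f y) →
      (∀ α, f (Y.branch α x) ≤ Real.exp (c * (Y.φ α : ℝ))) →
      Summable (fun α => Y.weight α x * f (Y.branch α x)) ∧
        ∑' α, Y.weight α x * f (Y.branch α x) ≤ M / z := by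
    intro x f hx hf0 hf
    have hs : Summable fun α => Y.weight α x * Real.exp (c * (Y.φ α : ℝ)) := by
      refine ((hge hx).1.div_const (Y.gSum x)).congr fun α => ?_
      rw [weight_of_eq_zero _ hx]
      ring
    have hle : ∀ α, Y.weight α x * f (Y.branch α x) ≤
        Y.weight α x * Real.exp (c * (Y.φ α : ℝ)) := fun α =>
      mul_le_mul_of_nonneg_left (hf α) (hwnn α x)
    have hs' := Summable.of_nonneg_of_le (fun α => mul_nonneg (hwnn α x) (hf0 _)) hle hs
    refine ⟨hs', (hs'.tsum_le_tsum hle hs).trans ?_⟩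
    have h1 : ∑' α, Y.weight α x * Real.exp (c * (Y.φ α : ℝ)) =
        (∑' α, Y.g (Y.branch α x) * Real.exp (c * (Y.φ α : ℝ))) / Y.gSum x := by
      rw [← tsum_div_const]
      refine tsum_congr fun α => ?_
      rw [weight_of_eq_zero _ hx]
      ring
    rw [h1]
    exact div_le_div₀ hM0.le (hge hx).2 hz0 (hZz hx)
  set ε := c / 3 with hε
  have hε0 : 0 < ε := by positivity
  set V : Δ → ℝ := fun x => Real.exp (ε * Y.height x) with hV
  have hV1 : ∀ x, 1 ≤ V x := fun x => Real.one_le_exp (by positivity)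
  have hV3 : ∀ {x}, Y.height x = 0 → ∀ α, V (Y.branch α x) ^ 3 ≤ Real.exp (c * (Y.φ α : ℝ)) := by
    intro x hx α
    have h1 : (Y.height (Y.branch α x) : ℝ) + 1 = Y.φ α := by
      exact_mod_cast (Y.label_branch_of_eq_zero α hx).2
    rw [hV, ← Real.exp_nat_mul, Real.exp_le_exp, ← h1, hε]
    push_cast
    nlinarith
  have hVle : ∀ {x}, Y.height x = 0 → ∀ α, V (Y.branch α x) ≤ Real.exp (c * (Y.φ α : ℝ)) :=
    fun hx α => (le_self_pow₀ (hV1 _) (by norm_num)).trans (hV3 hx α)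
  have hopne : ∀ {x} (f : Δ → ℝ), Y.height x ≠ 0 →
      HasSum (fun α => Y.weight α x * f (Y.branch α x)) (f (Y.branch (Y.index x) x)) := by
    intro x f hx
    have h1 := hasSum_single (f := fun α => Y.weight α x * f (Y.branch α x)) (Y.index x)
      fun α hα => by rw [weight_of_ne_zero _ hx, if_neg hα, zero_mul]
    simpa only [weight_of_ne_zero (Y.index x) hx, if_true, one_mul] using h1
  have hγ1 : Real.exp (-ε) < 1 := by simpa using hε0
  refine ⟨{ branch := Y.branch
            weight := Y.weight
            V := V
            D := fun x => if Y.height x = 0 then 2 * C * (1 + C) else 0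
            β := Y.β
            γ := Real.exp (-ε)
            Q := M / z / (1 - Real.exp (-ε))
            B := 2 * C * (1 + C) * (M / z)
            weight_nonneg := hwnn
            hasSum_weight := hws
            β_pos := Y.β_pos
            β_lt_one := Y.β_lt_one
            dist_branch := fun α x y h => (Y.dist_branch α h).le
            one_le_V := hV1
            summable_V := fun x => ?_
            γ_pos := Real.exp_pos _
            γ_lt_one := hγ1
            Q_nonneg := div_nonneg (by positivity) (by linarith)
            drift := fun x => ?_
            D_nonneg := fun x => ?_
            distortion := fun α x y hxy => ?_
            D_mul_le := fun x => ?_ }, rfl, rfl, rfl, ⟨ε, hε0, fun _ => rfl⟩, fun α => ?_,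
            M / z, fun x hx => hbd (fun y => V y ^ 3) hx (fun y => by positivity) (hV3 hx)⟩
  · by_cases hx : Y.height x = 0
    · exact (hbd V hx (fun y => by positivity) (hVle hx)).1
    · exact (hopne V hx).summable
  · have h1 : (1 - Real.exp (-ε)) * (M / z / (1 - Real.exp (-ε))) = M / z :=
      mul_div_cancel₀ _ (by linarith)
    rw [h1]
    by_cases hx : Y.height x = 0
    · have := (hbd V hx (fun y => by positivity) (hVle hx)).2
      have := mul_pos (Real.exp_pos (-ε)) (zero_lt_one.trans_le (hV1 x))
      linarith
    · rw [(hopne V hx).tsum_eq]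
      have h2 : V (Y.branch (Y.index x) x) = Real.exp (-ε) * V x := by
        have h3 : (Y.height (Y.branch (Y.index x) x) : ℝ) + 1 = Y.height x := by
          exact_mod_cast (Y.label_branch_of_ne_zero _ hx).2
        rw [hV, ← Real.exp_add, ← h3]
        ring_nf
      rw [h2]
      have : 0 < M / z := by positivity
      linarith
  · split_ifs <;> positivity
  · obtain ⟨h1, h2⟩ := Y.label_eq_of_dist_lt_one hxy
    by_cases hy : Y.height y = 0
    · have hx : Y.height x = 0 := h2.trans hy
      rw [if_pos hy, weight_of_eq_zero _ hx, weight_of_eq_zero _ hy]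
      have hd : ∀ α, |Y.g (Y.branch α x) - Y.g (Y.branch α y)| ≤
          C * dist x y * Y.g (Y.branch α y) := fun α => by
        have h3 := Y.label_branch_of_eq_zero α hx
        have h4 := Y.label_branch_of_eq_zero α hy
        have := hC (Y.branch α x) (Y.branch α y) (h3.1.trans h4.1.symm) (by omega)
        rwa [Y.T_branch, Y.T_branch] at this
      have hdZ : |Y.gSum y - Y.gSum x| ≤ C * dist x y * Y.gSum y := by
        rw [abs_sub_comm, gSum, gSum, ← (hgs hx).tsum_sub (hgs hy), ← tsum_mul_left]
        rw [← Real.norm_eq_abs]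
        exact tsum_of_norm_bounded ((hgs hy).mul_left (C * dist x y)).hasSum
          hd
      have hZZ : Y.gSum y ≤ (1 + C) * Y.gSum x := by
        rw [gSum, gSum, ← tsum_mul_left]
        exact (hgs hy).tsum_le_tsum (fun α => g_branch_le_g_branch hC0 hC α hy hx)
          ((hgs hx).mul_left _)
      have hx0 := hZ0 hx
      have hy0 := hZ0 hy
      have hgy := Y.g_pos (Y.branch α y)
      set a := Y.g (Y.branch α x)
      set b := Y.g (Y.branch α y)
      have e1 : a / Y.gSum x - b / Y.gSum y =
          ((a - b) * Y.gSum y + b * (Y.gSum y - Y.gSum x)) / (Y.gSum x * Y.gSum y) := by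
        field_simp
        ring
      rw [e1, abs_div, abs_of_pos (mul_pos hx0 hy0), div_le_iff₀ (mul_pos hx0 hy0)]
      have e2 : 2 * C * (1 + C) * dist x y * (b / Y.gSum y) * (Y.gSum x * Y.gSum y) =
          2 * C * dist x y * b * ((1 + C) * Y.gSum x) := by
        field_simp
      rw [e2]
      calc _ ≤ |a - b| * Y.gSum y + b * |Y.gSum y - Y.gSum x| := by
            refine (abs_add_le _ _).trans_eq ?_
            rw [abs_mul, abs_mul, abs_of_pos hy0, abs_of_pos hgy]
        _ ≤ (C * dist x y * b) * Y.gSum y + b * (C * dist x y * Y.gSum y) := by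
            gcongr
            exact hd α
        _ = 2 * C * dist x y * b * Y.gSum y := by ring
        _ ≤ _ := by gcongr
    · have hx : Y.height x ≠ 0 := h2 ▸ hy
      rw [weight_of_ne_zero _ hx, weight_of_ne_zero _ hy, h1, if_neg hy]
      simp
  · split_ifs with hx
    · exact mul_le_mul_of_nonneg_left (hbd V hx (fun y => by positivity) (hVle hx)).2
        (by positivity)
    · rw [zero_mul]
      positivity
  · refine ⟨Y.g (Y.branch α x₀) / (1 + C) / M, div_pos (div_pos (Y.g_pos _) hC1) hM0,
      fun x hx => ?_⟩
    change _ ≤ Y.weight α x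
    rw [weight_of_eq_zero _ hx]
    refine div_le_div₀ (Y.g_pos _).le ?_ (hZ0 hx) (hZM hx)
    rw [div_le_iff₀ hC1, mul_comm]
    exact g_branch_le_g_branch hC0 hC α hx₀ hx

end UniformYoungTower

namespace BranchSystem

variable {X ι : Type*} [MetricSpace X] {S : BranchSystem X ι}

/-- The chain started at `x` is at `x'` at time `N` with probability at least `δ`. -/
def Reaches (S : BranchSystem X ι) (N : ℕ) (δ : ℝ) (x x' : X) : Prop :=
  ∀ f, S.Dom f → (∀ z, 0 ≤ f z) → δ * f x' ≤ S.op^[N] f x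

lemma iterate_nonneg {f : X → ℝ} (hf : S.Dom f) (h0 : ∀ z, 0 ≤ f z) (m : ℕ) (x : X) :
    0 ≤ S.op^[m] f x := by
  have := iterate_le_iterate (S.dom_const 0) hf h0 m x
  rwa [iterate_const] at this

lemma Reaches.add {N M : ℕ} {δ ε : ℝ} {x y z : X} (h : S.Reaches N δ x y) (h' : S.Reaches M ε y z)
    (hδ : 0 ≤ δ) : S.Reaches (N + M) (δ * ε) x z := by
  intro f hf h0
  rw [Function.iterate_add_apply, mul_assoc]
  exact (mul_le_mul_of_nonneg_left (h' f hf h0) hδ).trans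
    (h _ (hf.iterate M) (iterate_nonneg hf h0 M))

lemma Reaches.mono {N : ℕ} {δ ε : ℝ} {x y : X} (h : S.Reaches N δ x y) (hε : ε ≤ δ) :
    S.Reaches N ε x y := fun f hf h0 =>
  (mul_le_mul_of_nonneg_right hε (h0 y)).trans (h f hf h0)

end BranchSystem

namespace UniformYoungTower

variable {Δ : Type*} [MetricSpace Δ] [MeasurableSpace Δ] [BorelSpace Δ] {ι : Type*} [Countable ι]
  {Y : UniformYoungTower Δ ι} {S : BranchSystem Δ ι}

namespace IsAdapted

lemma op_of_ne_zero (hS : Y.IsAdapted S) (f : Δ → ℝ) {x : Δ} (hx : Y.height x ≠ 0) (α : ι) :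
    S.op f x = f (Y.branch α x) := by
  rw [BranchSystem.op, hS.branch_eq, hS.weight_eq, tsum_eq_single (Y.index x),
    weight_of_ne_zero _ hx, if_pos rfl, one_mul, Y.branch_eq_of_ne_zero _ α hx]
  intro α' hα'
  rw [weight_of_ne_zero _ hx, if_neg hα', zero_mul]

lemma measurable_op (hS : Y.IsAdapted S) {f : Δ → ℝ} (hf : Measurable f) :
    Measurable (S.op f) := by
  have hg := Y.isInverseJacobian.measurable
  have hb := fun α => (Y.continuous_branch α).measurable
  have hZ : Measurable Y.gSum := Measurable.tsum fun α => hg.comp (hb α)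
  unfold BranchSystem.op
  rw [hS.weight_eq, hS.branch_eq]
  refine Measurable.tsum fun α => Measurable.mul ?_ (hf.comp (hb α))
  unfold weight
  refine Measurable.ite Y.measurableSet_base ((hg.comp (hb α)).div hZ) ?_
  exact Measurable.ite (Y.measurableSet_label fun a _ => α = a) measurable_const measurable_const

lemma integral_op_of_nonneg (hS : Y.IsAdapted S) {f : Δ → ℝ} (hf : Measurable f) (h0 : ∀ x, 0 ≤ f x)
    (hdom : S.Dom f) : ∫ x, S.op f x ∂Y.μ = ∫ x, f x ∂Y.μ := by
  have hop0 : ∀ x, 0 ≤ S.op f x := fun x => tsum_nonneg fun α =>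
    mul_nonneg (S.weight_nonneg α x) (h0 _)
  rw [integral_eq_lintegral_of_nonneg_ae (.of_forall hop0)
    (hS.measurable_op hf).aestronglyMeasurable, integral_eq_lintegral_of_nonneg_ae (.of_forall h0)
    hf.aestronglyMeasurable]
  congr 1
  have hf' : Measurable fun x => ENNReal.ofReal (f x) := hf.ennreal_ofReal
  rw [← lintegral_add_compl _ Y.measurableSet_base,
    ← lintegral_add_compl (fun x => ENNReal.ofReal (f x)) (Y.measurePreserving.measurable Y.measurableSet_base)]
  congr 1
  · rw [← Y.lintegral_tsum_branch hf']
    refine lintegral_congr_ae ?_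
    filter_upwards [Y.ae_tsum_g_branch, ae_restrict_mem Y.measurableSet_base] with x hx hxb
    have hZ : Y.gSum x = 1 := by
      have h1 := ENNReal.tsum_toReal_eq (f := fun α => ENNReal.ofReal (Y.g (Y.branch α x)))
        fun α => ENNReal.ofReal_ne_top
      rw [hx, ENNReal.toReal_one] at h1
      rw [gSum, h1]
      exact tsum_congr fun α => (ENNReal.toReal_ofReal (Y.g_pos _).le).symm
    rw [BranchSystem.op, ENNReal.ofReal_tsum_of_nonneg
      (fun α => mul_nonneg (S.weight_nonneg α x) (h0 _)) (hdom.summable x)]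
    refine tsum_congr fun α => ?_
    rw [ENNReal.ofReal_mul (S.weight_nonneg α x), hS.weight_eq, hS.branch_eq,
      weight_of_eq_zero α hxb, hZ, div_one]
  · rw [← preimage_compl, ← Y.measurePreserving.setLIntegral_comp_preimage
      Y.measurableSet_base.compl (hS.measurable_op hf).ennreal_ofReal]
    refine setLIntegral_congr_fun (Y.measurePreserving.measurable Y.measurableSet_base.compl)
      fun x hx => ?_
    rw [hS.op_of_ne_zero f hx (Y.index x), Y.branch_T_of_ne_zero _ hx]

/-- The transition operator preserves the integral. -/
lemma integral_op (hS : Y.IsAdapted S) {f : Δ → ℝ} (hf : Measurable f) {M : ℝ}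
    (hM : ∀ x, |f x| ≤ M) : ∫ x, S.op f x ∂Y.μ = ∫ x, f x ∂Y.μ := by
  have := Y.isProbabilityMeasure
  have hint : ∀ {h : Δ → ℝ}, Measurable h → (∀ x, |h x| ≤ M) → Integrable h Y.μ := fun hh hb =>
    Integrable.of_bound hh.aestronglyMeasurable M (.of_forall hb)
  have hdf : S.Dom f := BranchSystem.Dom.of_bound hM
  have h1 := hS.integral_op_of_nonneg (hf.add_const M)
    (fun x => by linarith [neg_le_of_abs_le (hM x)]) (hdf.add (S.dom_const M))
  rw [BranchSystem.op_add hdf (S.dom_const M), BranchSystem.op_const,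
    integral_add (hint (hS.measurable_op hf) (BranchSystem.abs_iterate_le hM 1))
      (integrable_const M), integral_add (hint hf hM) (integrable_const M)] at h1
  linarith

lemma exists_descend (hS : Y.IsAdapted S) (h : ℕ) {x y : Δ} (hi : Y.index x = Y.index y)
    (hx : Y.height x = h) (hy : Y.height y = h) :
    ∃ x' y', Y.height x' = 0 ∧ Y.height y' = 0 ∧ dist x' y' ≤ dist x y ∧
      ∀ f, S.op^[h] f x = f x' ∧ S.op^[h] f y = f y' := by
  induction h generalizing x y with
  | zero => exact ⟨x, y, hx, hy, le_rfl, fun f => ⟨rfl, rfl⟩⟩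
  | succ h ih =>
    have hx0 : Y.height x ≠ 0 := by omega
    have hy0 : Y.height y ≠ 0 := by omega
    have h1 := Y.label_branch_of_ne_zero (Y.index x) hx0
    have h2 := Y.label_branch_of_ne_zero (Y.index x) hy0
    have h3 : Y.index (Y.branch (Y.index x) x) = Y.index (Y.branch (Y.index x) y) := by
      rw [h1.1, h2.1, hi]
    obtain ⟨x', y', hx', hy', hd, hf⟩ := ih h3 (by omega) (by omega)
    refine ⟨x', y', hx', hy', hd.trans ?_, fun f => ?_⟩
    · rw [Y.dist_eq_mul_dist h3 (by omega), Y.T_branch, Y.T_branch]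
      exact mul_le_of_le_one_left dist_nonneg Y.β_lt_one.le
    · rw [Function.iterate_succ_apply', hS.op_of_ne_zero _ hx0 (Y.index x),
        hS.op_of_ne_zero _ hy0 (Y.index x)]
      exact hf f

lemma exists_return (hS : Y.IsAdapted S) (α : ι) : ∃ c > 0, ∀ x y, Y.height x = 0 →
    Y.height y = 0 → ∃ x' y', Y.height x' = 0 ∧ Y.height y' = 0 ∧
      dist x' y' ≤ Y.β * dist x y ∧ S.Reaches (Y.φ α) c x x' ∧ S.Reaches (Y.φ α) c y y' := by
  obtain ⟨c, hc, hw⟩ := hS.weight_lower α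
  refine ⟨c, hc, fun x y hx hy => ?_⟩
  have h1 := Y.label_branch_of_eq_zero α hx
  have h2 := Y.label_branch_of_eq_zero α hy
  obtain ⟨h, hh⟩ : ∃ h, Y.φ α = h + 1 := ⟨Y.φ α - 1, by have := Y.φ_pos α; omega⟩
  obtain ⟨x', y', hx', hy', hd, hf⟩ := hS.exists_descend h (h1.1.trans h2.1.symm)
    (by omega) (by omega)
  rw [Y.dist_branch_of_eq_zero α hx hy] at hd
  have key : ∀ z z', Y.height z = 0 → (∀ f, S.op^[h] f (Y.branch α z) = f z') →
      S.Reaches (Y.φ α) c z z' := by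
    intro z z' hz hz' f hdf h0
    have h3 := BranchSystem.weight_mul_le_op (hdf.iterate h) (BranchSystem.iterate_nonneg hdf h0 h) α z
    rw [hS.branch_eq, hz'] at h3
    rw [hh, Function.iterate_succ_apply']
    exact (mul_le_mul_of_nonneg_right (hw z hz) (h0 z')).trans h3
  exact ⟨x', y', hx', hy', hd, key x x' hx fun f => (hf f).1, key y y' hy fun f => (hf f).2⟩

lemma exists_close (hS : Y.IsAdapted S) (m : ℕ) : ∃ N, ∃ δ > 0, ∀ x y, Y.height x = 0 →
    Y.height y = 0 → ∃ x' y', Y.height x' = 0 ∧ Y.height y' = 0 ∧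
      dist x' y' ≤ Y.β ^ m ∧ S.Reaches N δ x x' ∧ S.Reaches N δ y y' := by
  induction m with
  | zero =>
    refine ⟨0, 1, one_pos, fun x y hx hy => ⟨x, y, hx, hy, ?_, fun f _ _ => ?_, fun f _ _ => ?_⟩⟩
    · simpa using Y.dist_le_one x y
    · simp
    · simp
  | succ m ih =>
    obtain ⟨x₀, -⟩ := Y.base_nonempty
    obtain ⟨N, δ, hδ, h⟩ := ih
    obtain ⟨c, hc, h'⟩ := hS.exists_return (Y.index x₀)
    refine ⟨N + Y.φ (Y.index x₀), δ * c, by positivity, fun x y hx hy => ?_⟩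
    obtain ⟨x', y', hx', hy', hd, hrx, hry⟩ := h x y hx hy
    obtain ⟨x'', y'', hx'', hy'', hd', hrx', hry'⟩ := h' x' y' hx' hy'
    refine ⟨x'', y'', hx'', hy'', ?_, hrx.add hrx' hδ.le, hry.add hry' hδ.le⟩
    rw [pow_succ']
    exact hd'.trans (mul_le_mul_of_nonneg_left hd Y.β_pos.le)

lemma exists_reaches_of_mem_closure (hS : Y.IsAdapted S) {n : ℕ}
    (hn : n ∈ AddSubmonoid.closure (range Y.φ)) :
    ∃ δ > 0, ∀ x, Y.height x = 0 → ∃ x', Y.height x' = 0 ∧ S.Reaches n δ x x' := by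
  induction hn using AddSubmonoid.closure_induction with
  | mem n hn =>
    obtain ⟨α, rfl⟩ := hn
    obtain ⟨c, hc, h⟩ := hS.exists_return α
    refine ⟨c, hc, fun x hx => ?_⟩
    obtain ⟨x', _, hx', -, -, hr, -⟩ := h x x hx hx
    exact ⟨x', hx', hr⟩
  | zero => exact ⟨1, one_pos, fun x hx => ⟨x, hx, fun f _ _ => by simp⟩⟩
  | add n m _ _ ihn ihm =>
    obtain ⟨δ, hδ, h⟩ := ihn
    obtain ⟨ε, hε, h'⟩ := ihm
    refine ⟨δ * ε, by positivity, fun x hx => ?_⟩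
    obtain ⟨x', hx', hr⟩ := h x hx
    obtain ⟨x'', hx'', hr'⟩ := h' x' hx'
    exact ⟨x'', hx'', hr.add hr' hδ.le⟩

/-- The base is visited at all large times with a probability that is bounded below. -/
lemma exists_reaches (hS : Y.IsAdapted S) : ∃ N, ∀ H, ∃ δ > 0, ∀ i ≤ H, ∀ x, Y.height x = 0 →
    ∃ x', Y.height x' = 0 ∧ S.Reaches (N + i) δ x x' := by
  obtain ⟨N, hN⟩ := Nat.exists_mem_closure_of_ge (range Y.φ)
  have hgcd : Nat.setGcd (range Y.φ) = 1 :=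
    Y.aperiodic _ fun α => Nat.setGcd_dvd_of_mem (mem_range_self α)
  have hmem : ∀ i, ∃ δ > 0, ∀ x, Y.height x = 0 →
      ∃ x', Y.height x' = 0 ∧ S.Reaches (N + i) δ x x' := fun i =>
    hS.exists_reaches_of_mem_closure (hN (N + i) (by omega) (by simp [hgcd]))
  refine ⟨N, fun H => ?_⟩
  induction H with
  | zero =>
    obtain ⟨δ, hδ, h⟩ := hmem 0
    refine ⟨δ, hδ, fun i hi => ?_⟩
    obtain rfl : i = 0 := by omega
    exact h
  | succ H ih =>
    obtain ⟨δ, hδ, h⟩ := ih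
    obtain ⟨ε, hε, h'⟩ := hmem (H + 1)
    refine ⟨min δ ε, by positivity, fun i hi x hx => ?_⟩
    rcases Nat.le_succ_iff.1 hi with hi | rfl
    · obtain ⟨x', hx', hr⟩ := h i hi x hx
      exact ⟨x', hx', hr.mono (min_le_left _ _)⟩
    · obtain ⟨x', hx', hr⟩ := h' x hx
      exact ⟨x', hx', hr.mono (min_le_right _ _)⟩

theorem minorized (hS : Y.IsAdapted S) : S.Minorized := by
  intro κ hκ R
  obtain ⟨ε, hε, hV⟩ := hS.V_eq
  obtain ⟨m, hm⟩ := exists_pow_lt_of_lt_one hκ Y.β_lt_one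
  obtain ⟨N₁, δ₁, hδ₁, hclose⟩ := hS.exists_close m
  obtain ⟨N₀, hreach⟩ := hS.exists_reaches
  set H := ⌈R / ε⌉₊ + 1 with hH
  obtain ⟨δ₂, hδ₂, hreach⟩ := hreach H
  refine ⟨H + N₀ + N₁, by omega, δ₂ * δ₁, by positivity, fun x y hx hy => ?_⟩
  have key : ∀ z, S.V z ≤ R → ∃ z', Y.height z' = 0 ∧ S.Reaches (H + N₀) δ₂ z z' := by
    intro z hz
    have hzH : Y.height z ≤ H := by
      rw [hV] at hz
      have h1 : ε * Y.height z ≤ R := by linarith [Real.add_one_le_exp (ε * Y.height z)]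
      have h2 : (Y.height z : ℝ) ≤ R / ε := by
        rw [le_div_iff₀ hε]
        linarith
      have : Y.height z ≤ ⌈R / ε⌉₊ := by exact_mod_cast h2.trans (Nat.le_ceil _)
      omega
    obtain ⟨z', _, hz', -, -, hdes⟩ := hS.exists_descend (Y.height z) (x := z) rfl rfl rfl
    obtain ⟨z'', hz'', hr⟩ := hreach (H - Y.height z) (by omega) z' hz'
    refine ⟨z'', hz'', fun f hdf h0 => ?_⟩
    have h1 : H + N₀ = Y.height z + (N₀ + (H - Y.height z)) := by omega
    rw [h1, Function.iterate_add_apply, (hdes _).1]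
    exact hr f hdf h0
  obtain ⟨x', hx', hrx⟩ := key x hx
  obtain ⟨y', hy', hry⟩ := key y hy
  obtain ⟨x'', y'', -, -, hd, hrx', hry'⟩ := hclose x' y' hx' hy'
  exact ⟨x'', y'', hd.trans hm.le, fun f hdf h0 =>
    ⟨hrx.add hrx' hδ₂.le f hdf h0, hry.add hry' hδ₂.le f hdf h0⟩⟩

end IsAdapted

end UniformYoungTower

/-- The convolution of a sequence with the powers of `r`. -/
def geomConv (a : ℕ → ℝ) (r : ℝ) (j : ℕ) : ℝ := ∑ i ∈ Finset.range (j + 1), a i * r ^ (j - i)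

lemma geomConv_succ (a : ℕ → ℝ) (r : ℝ) (j : ℕ) :
    geomConv a r (j + 1) = r * geomConv a r j + a (j + 1) := by
  rw [geomConv, Finset.sum_range_succ, geomConv, Finset.mul_sum, Nat.sub_self, pow_zero, mul_one]
  congr 1
  refine Finset.sum_congr rfl fun i hi => ?_
  rw [Nat.sub_add_comm (by have := Finset.mem_range.1 hi; omega), pow_succ]
  ring

lemma geomConv_nonneg {a : ℕ → ℝ} (ha : ∀ i, 0 ≤ a i) {r : ℝ} (hr : 0 ≤ r) (j : ℕ) :
    0 ≤ geomConv a r j :=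
  Finset.sum_nonneg fun i _ => mul_nonneg (ha i) (pow_nonneg hr _)

lemma le_geomConv {a : ℕ → ℝ} (ha : ∀ i, 0 ≤ a i) {r : ℝ} (hr : 0 ≤ r) (j : ℕ) :
    a j ≤ geomConv a r j := by
  have := Finset.single_le_sum (f := fun i => a i * r ^ (j - i))
    (fun i _ => mul_nonneg (ha i) (pow_nonneg hr _)) (Finset.self_mem_range_succ j)
  simpa [geomConv] using this

lemma geom_sum_le_inv {r : ℝ} (hr : 0 ≤ r) (hr1 : r < 1) (n : ℕ) :
    ∑ i ∈ Finset.range n, r ^ i ≤ (1 - r)⁻¹ := by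
  rw [← tsum_geometric_of_lt_one hr hr1]
  exact (summable_geometric_of_lt_one hr hr1).sum_le_tsum _ fun i _ => pow_nonneg hr i

lemma geomConv_le {a : ℕ → ℝ} {b : ℝ} (hab : ∀ i, a i ≤ b) (hb : 0 ≤ b) {r : ℝ} (hr : 0 ≤ r)
    (hr1 : r < 1) (j : ℕ) : geomConv a r j ≤ b * (1 - r)⁻¹ := by
  calc geomConv a r j ≤ ∑ i ∈ Finset.range (j + 1), b * r ^ (j - i) :=
        Finset.sum_le_sum fun i _ => mul_le_mul_of_nonneg_right (hab i) (pow_nonneg hr _)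
    _ = b * ∑ i ∈ Finset.range (j + 1), r ^ i := by
        rw [← Finset.mul_sum, ← Finset.sum_range_reflect (fun i => r ^ i)]
        simp
    _ ≤ _ := mul_le_mul_of_nonneg_left (geom_sum_le_inv hr hr1 _) hb

/-- Young's inequality for the convolution with the powers of `r`. -/
lemma sum_sq_geomConv_le (a : ℕ → ℝ) {r : ℝ} (hr : 0 ≤ r) (hr1 : r < 1) (N : ℕ) :
    ∑ j ∈ Finset.range N, geomConv a r j ^ 2 ≤
      ((1 - r)⁻¹) ^ 2 * ∑ j ∈ Finset.range N, a j ^ 2 := by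
  have h1r : 0 < 1 - r := by linarith
  have key : ∀ N, (1 - r) * ∑ j ∈ Finset.range (N + 1), geomConv a r j ^ 2 +
      r * geomConv a r N ^ 2 ≤ (1 - r)⁻¹ * ∑ j ∈ Finset.range (N + 1), a j ^ 2 := by
    intro N
    induction N with
    | zero =>
      have h2 : geomConv a r 0 = a 0 := by simp [geomConv]
      have h3 : 1 ≤ (1 - r)⁻¹ := (one_le_inv₀ h1r).2 (by linarith)
      simp only [zero_add, Finset.sum_range_one, h2]
      nlinarith [sq_nonneg (a 0)]
    | succ N ih =>
      rw [Finset.sum_range_succ, Finset.sum_range_succ (fun j => a j ^ 2), geomConv_succ]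
      have h2 : (r * geomConv a r N + a (N + 1)) ^ 2 ≤
          r * geomConv a r N ^ 2 + (1 - r)⁻¹ * a (N + 1) ^ 2 := by
        obtain ⟨b, hb⟩ : ∃ b, a (N + 1) = (1 - r) * b := ⟨a (N + 1) / (1 - r), by field_simp⟩
        rw [hb]
        have h4 : (1 - r)⁻¹ * ((1 - r) * b) ^ 2 = (1 - r) * b ^ 2 := by field_simp
        rw [h4]
        nlinarith [mul_nonneg (mul_nonneg hr h1r.le) (sq_nonneg (geomConv a r N - b))]
      linarith
  rcases N with _ | N
  · simp
  · have h2 := key N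
    have h3 : 0 ≤ r * geomConv a r N ^ 2 := by positivity
    have h4 := mul_le_mul_of_nonneg_left ((le_add_of_nonneg_right h3).trans h2)
      (inv_nonneg.2 h1r.le)
    rw [inv_mul_cancel_left₀ h1r.ne'] at h4
    rw [sq, mul_assoc]
    exact h4

lemma sum_min_one_le {r : ℝ} (hr : 0 ≤ r) (hr1 : r < 1) (s N : ℕ) {W : ℝ} (h : r ^ s * W ≤ 1) :
    ∑ m ∈ Finset.range N, min 1 (r ^ m * W) ≤ s + (1 - r)⁻¹ := by
  induction s generalizing N W with
  | zero =>
    refine le_trans (Finset.sum_le_sum fun m _ => ?_) ((geom_sum_le_inv hr hr1 N).trans (by simp))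
    exact (min_le_right _ _).trans (mul_le_of_le_one_right (pow_nonneg hr _) (by simpa using h))
  | succ s ih =>
    rcases N with _ | N
    · have : 0 < 1 - r := by linarith
      simp only [Finset.range_zero, Finset.sum_empty]
      positivity
    · rw [Finset.sum_range_succ']
      have h1 := ih N (W := r * W) (by rw [← mul_assoc, ← pow_succ]; exact h)
      have h2 : ∀ m, r ^ (m + 1) * W = r ^ m * (r * W) := fun m => by ring
      simp only [h2]
      have := min_le_left 1 (r ^ 0 * W)
      push_cast
      linarith

/-- The number of `m` with `r ^ m * W ≥ 1` is logarithmic in `W`. -/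
lemma sum_min_one_le_log {r : ℝ} (hr : 0 < r) (hr1 : r < 1) (N : ℕ) {W : ℝ} (hW : 1 ≤ W) :
    ∑ m ∈ Finset.range N, min 1 (r ^ m * W) ≤
      Real.log W / Real.log r⁻¹ + (1 + (1 - r)⁻¹) := by
  have hL : 0 < Real.log r⁻¹ := Real.log_pos ((one_lt_inv₀ hr).2 hr1)
  have hlW : 0 ≤ Real.log W := Real.log_nonneg hW
  have h1 := Nat.le_ceil (Real.log W / Real.log r⁻¹)
  have h2 := Nat.ceil_lt_add_one (div_nonneg hlW hL.le)
  set s := ⌈Real.log W / Real.log r⁻¹⌉₊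
  have h3 : r ^ s * W ≤ 1 := by
    rw [div_le_iff₀ hL] at h1
    have h4 : W ≤ r⁻¹ ^ s := by
      rw [← Real.log_le_log_iff (by linarith) (by positivity), Real.log_pow]
      exact h1
    calc r ^ s * W ≤ r ^ s * r⁻¹ ^ s := by gcongr
      _ = 1 := by rw [← mul_pow, mul_inv_cancel₀ hr.ne', one_pow]
  have := sum_min_one_le hr.le hr1 s N h3
  linarith

lemma exp_le_one_add_add_sq_mul_exp_abs (x : ℝ) :
    Real.exp x ≤ 1 + x + x ^ 2 * Real.exp |x| := by
  have h1 : 1 ≤ Real.exp |x| := Real.one_le_exp (abs_nonneg x)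
  have h2 : x ^ 2 ≤ x ^ 2 * Real.exp |x| := le_mul_of_one_le_right (sq_nonneg x) h1
  rcases le_or_gt |x| 1 with h | h
  · have := le_of_abs_le (Real.abs_exp_sub_one_sub_id_le h)
    linarith
  · rcases lt_abs.1 h with h | h
    · rw [abs_of_pos (by linarith)]
      have := le_mul_of_one_le_left (Real.exp_pos x).le (one_le_pow₀ h.le : 1 ≤ x ^ 2)
      linarith
    · have : Real.exp x ≤ 1 := Real.exp_le_one_iff.2 (by linarith)
      nlinarith

namespace BranchSystem

variable {X ι : Type*} [MetricSpace X] {S : BranchSystem X ι} {T : X → X}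

lemma dom_sum {κ : Type*} {s : Finset κ} {f : κ → X → ℝ} (hf : ∀ i, S.Dom (f i)) :
    S.Dom fun x => ∑ i ∈ s, f i x := by
  classical
  induction s using Finset.induction with
  | empty => simpa using S.dom_const 0
  | insert a s ha ih => simpa only [Finset.sum_insert ha] using (hf a).add ih

lemma iterate_sum {κ : Type*} (s : Finset κ) {f : κ → X → ℝ} (hf : ∀ i, S.Dom (f i)) (m : ℕ)
    (x : X) : S.op^[m] (fun x => ∑ i ∈ s, f i x) x = ∑ i ∈ s, S.op^[m] (f i) x := by
  classical
  induction s using Finset.induction with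
  | empty => simp [iterate_const]
  | insert a s ha ih =>
    simp only [Finset.sum_insert ha]
    rw [iterate_add (hf a) (dom_sum hf)]
    exact congrArg _ ih

/-- The iterates of the operator only depend on the values along the backward orbits. -/
lemma iterate_congr (hT : ∀ α x, T (S.branch α x) = x) (m : ℕ) {f f' : X → ℝ} {y : X}
    (h : ∀ w, T^[m] w = y → f w = f' w) : S.op^[m] f y = S.op^[m] f' y := by
  induction m generalizing f f' with
  | zero => exact h y rfl
  | succ m ih =>
    refine ih fun w hw => tsum_congr fun α => ?_
    rw [h (S.branch α w) (by rw [Function.iterate_succ_apply, hT, hw])]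

/-- If `G` is Lipschitz along the contracting pairs of orbits of length `j`, then the `j`-th
iterate is Lipschitz. -/
lemma abs_iterate_sub_iterate_le (hT : ∀ α x, T (S.branch α x) = x) (j : ℕ) {G : X → ℝ} {b ℓ : ℝ}
    (hb : ∀ x, |G x| ≤ b)
    (hG : ∀ x y, dist (T^[j] x) (T^[j] y) < 1 →
      (∀ i ≤ j, dist (T^[i] x) (T^[i] y) ≤ S.β ^ (j - i) * dist (T^[j] x) (T^[j] y)) →
      |G x - G y| ≤ ℓ * dist (T^[j] x) (T^[j] y)) {x y : X} (hxy : dist x y < 1) :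
    |S.op^[j] G x - S.op^[j] G y| ≤
      (ℓ + b * S.B * ∑ i ∈ Finset.range j, S.β ^ i) * dist x y := by
  induction j generalizing G ℓ with
  | zero => simpa using hG x y hxy (by simp)
  | succ j ih =>
    have hb0 : 0 ≤ b := (abs_nonneg _).trans (hb x)
    have hB0 := S.B_nonneg x
    have := ih (G := S.op G) (ℓ := ℓ + b * S.B * S.β ^ j) (abs_iterate_le hb 1) fun x y hj hi => ?_
    · rw [Finset.sum_range_succ]
      rw [Function.iterate_succ_apply]
      refine this.trans (le_of_eq ?_)
      ring
    · have h0 : dist x y ≤ S.β ^ j * dist (T^[j] x) (T^[j] y) := by simpa using hi 0 (Nat.zero_le j)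
      have hpow : S.β ^ j ≤ 1 := pow_le_one₀ S.β_pos.le S.β_lt_one.le
      have h1 : dist x y < 1 :=
        (h0.trans (mul_le_of_le_one_left dist_nonneg hpow)).trans_lt hj
      refine (abs_op_sub_op_le (c := 0) (a := b) (e := ℓ * dist (T^[j] x) (T^[j] y)) (fun z => ?_)
        h1 fun α => ?_).trans ?_
      · rw [sub_zero]
        exact (hb z).trans (le_mul_of_one_le_right hb0 (S.one_le_V z))
      · have h2 : ∀ i z, T^[i + 1] (S.branch α z) = T^[i] z := fun i z => by
          rw [Function.iterate_succ_apply, hT]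
        have h3 := hG (S.branch α x) (S.branch α y) (by rw [h2, h2]; exact hj) fun i hij => ?_
        · rwa [h2, h2] at h3
        · rw [h2, h2]
          rcases i with _ | i
          · calc dist (S.branch α x) (S.branch α y) ≤ S.β * dist x y := S.dist_branch α x y h1
              _ ≤ S.β * (S.β ^ j * dist (T^[j] x) (T^[j] y)) :=
                mul_le_mul_of_nonneg_left h0 S.β_pos.le
              _ = _ := by rw [Nat.sub_zero]; ring
          · rw [h2, h2, Nat.add_sub_add_right]
            exact hi i (by omega)
      · have := mul_le_mul_of_nonneg_left h0 (mul_nonneg hb0 hB0)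
        linarith

end BranchSystem

/-- `K` is Lipschitz on the space of sequences, with constant `ℓ i` in the `i`-th variable and
dependence on the first `n` variables only. -/
def SeqLipschitz {X : Type*} [MetricSpace X] (K : (ℕ → X) → ℝ) (ℓ : ℕ → ℝ) (n : ℕ) : Prop :=
  ∀ z z' : ℕ → X, |K z - K z'| ≤ ∑ i ∈ Finset.range n, ℓ i * dist (z i) (z' i)

lemma SeqLipschitz.abs_sub_le {X : Type*} [MetricSpace X] {K : (ℕ → X) → ℝ} {ℓ : ℕ → ℝ} {n : ℕ}
    (hK : SeqLipschitz K ℓ n) (hℓ : ∀ i, 0 ≤ ℓ i) (s : Finset ℕ) {z z' : ℕ → X}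
    (h : ∀ i, i ∉ s → z i = z' i) : |K z - K z'| ≤ ∑ i ∈ s, ℓ i * dist (z i) (z' i) := by
  classical
  calc |K z - K z'| ≤ ∑ i ∈ Finset.range n, ℓ i * dist (z i) (z' i) := hK z z'
    _ ≤ ∑ i ∈ Finset.range n ∪ s, ℓ i * dist (z i) (z' i) :=
      Finset.sum_le_sum_of_subset_of_nonneg Finset.subset_union_left
        fun i _ _ => mul_nonneg (hℓ i) dist_nonneg
    _ = _ := (Finset.sum_subset Finset.subset_union_right fun i _ hi => by
        rw [h i hi, dist_self, mul_zero]).symm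

namespace UniformYoungTower

variable {Δ : Type*} [MetricSpace Δ] [MeasurableSpace Δ] [BorelSpace Δ] {ι : Type*} [Countable ι]
  {Y : UniformYoungTower Δ ι} {S : BranchSystem Δ ι}

lemma IsAdapted.T_branch (hS : Y.IsAdapted S) (α : ι) (x : Δ) : Y.T (S.branch α x) = x := by
  rw [hS.branch_eq, Y.T_branch]

/-- The oscillation of `S.op^[p]` applied to a function of the orbit, over two points with the
same image. -/
theorem IsAdapted.exists_oscillation (hS : Y.IsAdapted S) :
    ∃ C ρ : ℝ, 0 < C ∧ 0 < ρ ∧ ρ < 1 ∧ ∀ (K : (ℕ → Δ) → ℝ) (ℓ : ℕ → ℝ) (n : ℕ), (∀ i, 0 ≤ ℓ i) →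
      SeqLipschitz K ℓ n → ∀ (p : ℕ) (y y' : Δ), Y.T y = Y.T y' →
        |S.op^[p] (fun w => K fun i => Y.T^[i] w) y - S.op^[p] (fun w => K fun i => Y.T^[i] w) y'| ≤
          C * ∑ j ∈ Finset.range (p + 1),
            geomConv ℓ Y.β j * min 1 (ρ ^ (p - j) * (S.V y + S.V y')) := by
  obtain ⟨o, -⟩ := Y.base_nonempty
  have : Nonempty Δ := ⟨o⟩
  obtain ⟨C, ρ, hC, hρ0, hρ1, hdecay⟩ := BranchSystem.exists_decay hS.minorized
  have hβ0 := Y.β_pos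
  have hβ1 := Y.β_lt_one
  have hB := S.B_nonneg o
  have h1β : 0 < 1 - Y.β := by linarith
  set B' := S.B * (1 - Y.β)⁻¹ with hB'
  have hB'0 : 0 ≤ B' := by positivity
  refine ⟨2 + C * (2 + B'), ρ, by positivity, hρ0, hρ1, fun K ℓ n hℓ hK p y y' hyy' => ?_⟩
  set Z : ℕ → Δ → ℕ → Δ := fun q w i =>
    if i < q then Y.T^[i] w else if i ≤ p then o else Y.T^[i - (p + 1)] (Y.T y) with hZ
  set G : ℕ → Δ → ℝ := fun j w => K (Z (j + 1) w) - K (Z j w) with hG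
  have hGb : ∀ j w, |G j w| ≤ ℓ j := by
    intro j w
    refine (hK.abs_sub_le hℓ {j} fun i hi => ?_).trans ?_
    · have hij : i ≠ j := by simpa using hi
      simp only [hZ]
      by_cases h : i < j
      · rw [if_pos h, if_pos (by omega)]
      · rw [if_neg h, if_neg (by omega)]
    · rw [Finset.sum_singleton]
      exact mul_le_of_le_one_right (hℓ j) (Y.dist_le_one _ _)
  have hM0 := geomConv_nonneg hℓ hβ0.le
  have hℓM := le_geomConv hℓ hβ0.le
  have hGl : ∀ j x y, dist (Y.T^[j] x) (Y.T^[j] y) < 1 →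
      (∀ i ≤ j, dist (Y.T^[i] x) (Y.T^[i] y) ≤ S.β ^ (j - i) * dist (Y.T^[j] x) (Y.T^[j] y)) →
      |G j x - G j y| ≤ (2 * geomConv ℓ Y.β j) * dist (Y.T^[j] x) (Y.T^[j] y) := by
    intro j x y _ hi
    rw [hS.β_eq] at hi
    have hq : ∀ q ≤ j + 1, |K (Z q x) - K (Z q y)| ≤
        geomConv ℓ Y.β j * dist (Y.T^[j] x) (Y.T^[j] y) := by
      intro q hq
      refine (hK.abs_sub_le hℓ (Finset.range (j + 1)) fun i hi => ?_).trans ?_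
      · have : ¬ i < q := by have := Finset.mem_range.not.1 hi; omega
        simp only [hZ, if_neg this]
      · rw [geomConv, Finset.sum_mul]
        refine Finset.sum_le_sum fun i hij => ?_
        rw [mul_assoc]
        refine mul_le_mul_of_nonneg_left ?_ (hℓ i)
        simp only [hZ]
        split_ifs
        · exact hi i (by have := Finset.mem_range.1 hij; omega)
        all_goals
          rw [dist_self]
          positivity
    have h1 := hq (j + 1) le_rfl
    have h2 := hq j (by omega)
    have h3 : G j x - G j y = (K (Z (j + 1) x) - K (Z (j + 1) y)) - (K (Z j x) - K (Z j y)) := by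
      simp only [hG]
      ring
    rw [h3]
    refine (abs_sub _ _).trans ?_
    linarith
  have hGdom : ∀ j, S.Dom (G j) := fun j => BranchSystem.Dom.of_bound (hGb j)
  have hterm : ∀ j ∈ Finset.range (p + 1), |S.op^[p] (G j) y - S.op^[p] (G j) y'| ≤
      (2 + C * (2 + B')) * (geomConv ℓ Y.β j * min 1 (ρ ^ (p - j) * (S.V y + S.V y'))) := by
    intro j hj
    have hjp : j ≤ p := by have := Finset.mem_range.1 hj; omega
    have hlip : ∀ x y, dist x y < 1 → |S.op^[j] (G j) x - S.op^[j] (G j) y| ≤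
        ((2 + B') * geomConv ℓ Y.β j) * dist x y := by
      intro x y hxy
      refine (BranchSystem.abs_iterate_sub_iterate_le hS.T_branch j (hGb j) (hGl j) hxy).trans ?_
      apply mul_le_mul_of_nonneg_right _ dist_nonneg
      rw [hS.β_eq]
      have h1 := geom_sum_le_inv hβ0.le hβ1 j
      have h2 : ℓ j * S.B * ∑ i ∈ Finset.range j, Y.β ^ i ≤
          geomConv ℓ Y.β j * S.B * (1 - Y.β)⁻¹ := by
        have := hℓM j
        have := hM0 j
        gcongr
      rw [hB']
      linarith
    have hbd : ∀ x, |S.op^[j] (G j) x| ≤ (2 + B') * geomConv ℓ Y.β j := by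
      intro x
      have h1 := BranchSystem.abs_iterate_le (S := S) (hGb j) j x
      nlinarith [hM0 j, hℓM j]
    obtain ⟨c, hc⟩ := hdecay _ _ hbd hlip (p - j)
    simp only [← Function.iterate_add_apply, Nat.sub_add_cancel hjp] at hc
    have h1 : |S.op^[p] (G j) y - S.op^[p] (G j) y'| ≤
        C * (2 + B') * geomConv ℓ Y.β j * (ρ ^ (p - j) * (S.V y + S.V y')) := by
      have h2 := hc y
      have h3 := hc y'
      rw [abs_sub_comm] at h3
      refine (abs_sub_le _ c _).trans ((add_le_add h2 h3).trans_eq ?_)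
      ring
    have h2 : |S.op^[p] (G j) y - S.op^[p] (G j) y'| ≤ 2 * geomConv ℓ Y.β j := by
      have h3 := BranchSystem.abs_iterate_le (S := S) (hGb j) p y
      have h4 := BranchSystem.abs_iterate_le (S := S) (hGb j) p y'
      have h5 := hℓM j
      refine (abs_sub _ _).trans ?_
      linarith
    have hCB : 0 ≤ C * (2 + B') := by positivity
    rcases min_cases 1 (ρ ^ (p - j) * (S.V y + S.V y')) with ⟨h, -⟩ | ⟨h, -⟩
    · rw [h]
      nlinarith [hM0 j, mul_nonneg hCB (hM0 j)]
    · rw [h]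
      have h6 : 0 ≤ geomConv ℓ Y.β j * (ρ ^ (p - j) * (S.V y + S.V y')) := by
        have := hM0 j
        have := S.V_pos y
        have := S.V_pos y'
        positivity
      nlinarith
  have hval : ∀ v, Y.T v = Y.T y → S.op^[p] (fun w => K fun i => Y.T^[i] w) v =
      ∑ j ∈ Finset.range (p + 1), S.op^[p] (G j) v + K (Z 0 y) := by
    intro v hv
    have h1 : S.op^[p] (fun w => K fun i => Y.T^[i] w) v =
        S.op^[p] (fun w => ∑ j ∈ Finset.range (p + 1), G j w + K (Z 0 y)) v := by
      refine BranchSystem.iterate_congr hS.T_branch p fun w hw => ?_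
      have h2 : Z 0 w = Z 0 y := by
        funext i
        simp [hZ]
      rw [hG, Finset.sum_range_sub (fun q => K (Z q w)), h2, sub_add_cancel]
      congr 1
      funext i
      simp only [hZ]
      by_cases hi : i < p + 1
      · rw [if_pos hi]
      · rw [if_neg hi, if_neg (by omega), ← hv, ← hw, ← Function.iterate_succ_apply' Y.T,
          ← Function.iterate_add_apply, Nat.sub_add_cancel (by omega)]
    rw [h1, BranchSystem.iterate_add (BranchSystem.dom_sum hGdom) (S.dom_const _),
      BranchSystem.iterate_const]
    exact congrArg (· + _) (BranchSystem.iterate_sum _ hGdom p v)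
  rw [hval y rfl, hval y' hyy'.symm, add_sub_add_right_eq_sub, ← Finset.sum_sub_distrib,
    Finset.mul_sum]
  exact (Finset.abs_sum_le_sum_abs _ _).trans (Finset.sum_le_sum hterm)

end UniformYoungTower

namespace UniformYoungTower

variable {Δ : Type*} [MetricSpace Δ] [MeasurableSpace Δ] [BorelSpace Δ] {ι : Type*} [Countable ι]
  {Y : UniformYoungTower Δ ι} {S : BranchSystem Δ ι}

lemma dist_iterate_le (Y : UniformYoungTower Δ ι) (i : ℕ) (x y : Δ) :
    dist (Y.T^[i] x) (Y.T^[i] y) ≤ Y.β⁻¹ ^ i * dist x y := by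
  induction i with
  | zero => simp
  | succ i ih =>
    rw [Function.iterate_succ_apply', Function.iterate_succ_apply', pow_succ', mul_assoc]
    exact (Y.dist_T_le _ _).trans (mul_le_mul_of_nonneg_left ih (inv_nonneg.2 Y.β_pos.le))

lemma abs_orbit_sub_orbit_le {K : (ℕ → Δ) → ℝ} {ℓ : ℕ → ℝ} {n : ℕ} (hℓ : ∀ i, 0 ≤ ℓ i)
    (hK : SeqLipschitz K ℓ n) (x y : Δ) :
    |K (fun i => Y.T^[i] x) - K (fun i => Y.T^[i] y)| ≤
      (∑ i ∈ Finset.range n, ℓ i * Y.β⁻¹ ^ i) * dist x y := by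
  refine (hK _ _).trans ?_
  rw [Finset.sum_mul]
  refine Finset.sum_le_sum fun i _ => ?_
  rw [mul_assoc]
  exact mul_le_mul_of_nonneg_left (Y.dist_iterate_le i x y) (hℓ i)

lemma continuous_orbit {K : (ℕ → Δ) → ℝ} {ℓ : ℕ → ℝ} {n : ℕ} (hℓ : ∀ i, 0 ≤ ℓ i)
    (hK : SeqLipschitz K ℓ n) : Continuous fun x => K fun i => Y.T^[i] x :=
  (LipschitzWith.of_dist_le' fun x y => by
    rw [Real.dist_eq]
    exact abs_orbit_sub_orbit_le hℓ hK x y).continuous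

lemma exists_orbit_bound {K : (ℕ → Δ) → ℝ} {ℓ : ℕ → ℝ} {n : ℕ} (hℓ : ∀ i, 0 ≤ ℓ i)
    (hK : SeqLipschitz K ℓ n) : ∃ b, ∀ x, |K fun i => Y.T^[i] x| ≤ b := by
  obtain ⟨o, -⟩ := Y.base_nonempty
  refine ⟨|K fun _ => o| + ∑ i ∈ Finset.range n, ℓ i, fun x => ?_⟩
  have h1 := hK (fun i => Y.T^[i] x) fun _ => o
  have h2 : ∑ i ∈ Finset.range n, ℓ i * dist (Y.T^[i] x) o ≤ ∑ i ∈ Finset.range n, ℓ i :=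
    Finset.sum_le_sum fun i _ => mul_le_of_le_one_right (hℓ i) (Y.dist_le_one _ _)
  have h3 := abs_sub_abs_le_abs_sub (K fun i => Y.T^[i] x) (K fun _ => o)
  linarith

namespace IsAdapted

/-- The conditional exponential moments of one martingale increment. -/
theorem exists_step (hS : Y.IsAdapted S) :
    ∃ ε₀ C ρ : ℝ, 0 < ε₀ ∧ 0 < C ∧ 0 < ρ ∧ ρ < 1 ∧ ∀ (K : (ℕ → Δ) → ℝ) (ℓ : ℕ → ℝ) (n : ℕ),
      (∀ i, 0 ≤ ℓ i) → (∀ i, ℓ i ≤ ε₀) → SeqLipschitz K ℓ n → ∀ (p : ℕ) (x : Δ),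
        S.op (fun w => Real.exp (S.op^[p] (fun w => K fun i => Y.T^[i] w) w)) x ≤
          Real.exp (S.op^[p + 1] (fun w => K fun i => Y.T^[i] w) x +
            C * geomConv (geomConv ℓ Y.β) ρ p ^ 2) := by
  obtain ⟨o, -⟩ := Y.base_nonempty
  obtain ⟨C₀, ρ, hC₀, hρ0, hρ1, hosc⟩ := hS.exists_oscillation
  obtain ⟨ε, hε, hV⟩ := hS.V_eq
  obtain ⟨M, hM⟩ := hS.cube
  have hβ0 := Y.β_pos
  have hβ1 := Y.β_lt_one
  have h1β : 0 < 1 - Y.β := by linarith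
  have h1ρ : 0 < 1 - ρ := by linarith
  have hL : 0 < Real.log ρ⁻¹ := Real.log_pos ((one_lt_inv₀ hρ0).2 hρ1)
  set A := (Real.log ρ⁻¹)⁻¹ + (1 + (1 - ρ)⁻¹) with hA
  have hA0 : 0 < A := by positivity
  set V₀ := Real.exp (ε * Y.φ (Y.index o)) with hV₀
  have hV₀1 : 1 ≤ V₀ := Real.one_le_exp (by positivity)
  set ε₀ := (1 - Y.β) / (C₀ * A) with hε₀
  have hε₀0 : 0 < ε₀ := by positivity
  set M' := max M 1 with hM'
  have hM'0 : 0 < M' := lt_max_of_lt_right one_pos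
  refine ⟨ε₀, C₀ ^ 2 * Real.exp 1 * (2 * V₀) ^ 3 * M', ρ, hε₀0, by positivity, hρ0, hρ1,
    fun K ℓ n hℓ hℓε hK p x => ?_⟩
  set k : Δ → ℝ := fun w => K fun i => Y.T^[i] w with hk
  set U := geomConv (geomConv ℓ Y.β) ρ p with hU
  have hconv0 := geomConv_nonneg hℓ hβ0.le
  have hU0 : 0 ≤ U := geomConv_nonneg hconv0 hρ0.le p
  rw [Function.iterate_succ_apply']
  by_cases hx : Y.height x = 0
  swap
  · rw [hS.op_of_ne_zero _ hx (Y.index x), hS.op_of_ne_zero _ hx (Y.index x), Real.exp_le_exp]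
    have : 0 ≤ C₀ ^ 2 * Real.exp 1 * (2 * V₀) ^ 3 * M' * U ^ 2 := by positivity
    linarith
  obtain ⟨b, hb⟩ := exists_orbit_bound (Y := Y) hℓ hK
  have hbdd : ∀ w, |S.op^[p] k w| ≤ b := BranchSystem.abs_iterate_le hb p
  have hdom : S.Dom (S.op^[p] k) := BranchSystem.Dom.of_bound hbdd
  set c := S.op^[p] k (S.branch (Y.index o) x) with hc
  set q := C₀ ^ 2 * Real.exp 1 * (2 * V₀) ^ 3 * U ^ 2 with hq
  have hq0 : 0 ≤ q := by positivity
  have hVo : S.V (S.branch (Y.index o) x) ≤ V₀ := by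
    rw [hV, hV₀, Real.exp_le_exp, hS.branch_eq]
    have : Y.height (Y.branch (Y.index o) x) ≤ Y.φ (Y.index o) := by
      have := (Y.label_branch_of_eq_zero (Y.index o) hx).2
      omega
    gcongr
  have hkey : ∀ α, Real.exp (S.op^[p] k (S.branch α x)) ≤
      Real.exp c * (1 + (S.op^[p] k (S.branch α x) - c) + q * S.V (S.branch α x) ^ 3) := by
    intro α
    set y := S.branch α x with hy
    set t := S.op^[p] k y - c with ht
    have hVy := S.one_le_V y
    set W := 2 * V₀ * S.V y with hW
    have hW1 : 1 ≤ W := by nlinarith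
    have hVW : S.V y + S.V (S.branch (Y.index o) x) ≤ W := by nlinarith
    have hto := hosc K ℓ n hℓ hK p y (S.branch (Y.index o) x) (by rw [hS.T_branch, hS.T_branch])
    have hminle : ∀ j, geomConv ℓ Y.β j * min 1 (ρ ^ (p - j) *
        (S.V y + S.V (S.branch (Y.index o) x))) ≤ geomConv ℓ Y.β j * min 1 (ρ ^ (p - j) * W) :=
      fun j => by
        have := hconv0 j
        gcongr
    have ht1 : |t| ≤ C₀ * (W * U) := by
      refine hto.trans (mul_le_mul_of_nonneg_left ?_ hC₀.le)
      rw [hU, geomConv, Finset.mul_sum]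
      refine Finset.sum_le_sum fun j _ => (hminle j).trans ?_
      calc _ ≤ geomConv ℓ Y.β j * (ρ ^ (p - j) * W) :=
            mul_le_mul_of_nonneg_left (min_le_right _ _) (hconv0 j)
        _ = _ := by ring
    have ht2 : |t| ≤ 1 + Real.log W := by
      have hlW := Real.log_nonneg hW1
      have h1 : ∀ j, geomConv ℓ Y.β j ≤ ε₀ * (1 - Y.β)⁻¹ := geomConv_le hℓε hε₀0.le hβ0.le hβ1
      have h2 : ∑ j ∈ Finset.range (p + 1), min 1 (ρ ^ (p - j) * W) ≤ A * (1 + Real.log W) := by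
        have h3 := sum_min_one_le_log hρ0 hρ1 (p + 1) hW1
        rw [← Finset.sum_range_reflect] at h3
        simp only [Nat.add_sub_cancel] at h3
        refine h3.trans ?_
        have h4 : 0 ≤ (Real.log ρ⁻¹)⁻¹ := by positivity
        have h5 : 0 ≤ (1 + (1 - ρ)⁻¹) * Real.log W := by positivity
        rw [hA, div_eq_mul_inv]
        linarith
      calc |t| ≤ C₀ * ∑ j ∈ Finset.range (p + 1),
            (ε₀ * (1 - Y.β)⁻¹) * min 1 (ρ ^ (p - j) * W) := by
            refine hto.trans (mul_le_mul_of_nonneg_left ?_ hC₀.le)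
            refine Finset.sum_le_sum fun j _ => (hminle j).trans ?_
            have : 0 ≤ min 1 (ρ ^ (p - j) * W) := by positivity
            exact mul_le_mul_of_nonneg_right (h1 j) this
        _ ≤ C₀ * ((ε₀ * (1 - Y.β)⁻¹) * (A * (1 + Real.log W))) := by
            rw [← Finset.mul_sum]
            gcongr
        _ = 1 + Real.log W := by
            rw [hε₀]
            field_simp
    have h3 : t ^ 2 * Real.exp |t| ≤ q * S.V y ^ 3 := by
      have h4 : t ^ 2 ≤ (C₀ * (W * U)) ^ 2 := by
        rw [← sq_abs t]
        gcongr
      have h5 : Real.exp |t| ≤ Real.exp 1 * W := by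
        refine (Real.exp_le_exp.2 ht2).trans_eq ?_
        rw [Real.exp_add, Real.exp_log (by linarith)]
      calc _ ≤ (C₀ * (W * U)) ^ 2 * (Real.exp 1 * W) := by gcongr
        _ = _ := by rw [hq, hW]; ring
    have h4 : Real.exp (S.op^[p] k y) = Real.exp c * Real.exp t := by
      rw [← Real.exp_add, ht]
      ring_nf
    rw [h4]
    have := exp_le_one_add_add_sq_mul_exp_abs t
    gcongr
    linarith
  obtain ⟨hMs, hMle⟩ := hM x hx
  have hsum1 : HasSum (fun α => S.weight α x * (S.op^[p] k (S.branch α x) - c))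
      (S.op (S.op^[p] k) x - c) := by
    have h1 := (hdom.summable x).hasSum.sub ((S.hasSum_weight x).mul_right c)
    rw [one_mul] at h1
    refine h1.congr_fun fun α => ?_
    ring
  have hsum : HasSum (fun α => S.weight α x * (Real.exp c *
      (1 + (S.op^[p] k (S.branch α x) - c) + q * S.V (S.branch α x) ^ 3)))
      (Real.exp c * (1 + (S.op (S.op^[p] k) x - c) +
        q * ∑' α, S.weight α x * S.V (S.branch α x) ^ 3)) := by
    have h1 := (((S.hasSum_weight x).add hsum1).add (hMs.hasSum.mul_left q)).mul_left (Real.exp c)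
    refine h1.congr_fun fun α => ?_
    ring
  have hexpb : S.Dom fun w => Real.exp (S.op^[p] k w) :=
    BranchSystem.Dom.of_bound (M := Real.exp b) fun w => by
      rw [Real.abs_exp, Real.exp_le_exp]
      exact le_of_abs_le (hbdd w)
  have h1 : S.op (fun w => Real.exp (S.op^[p] k w)) x ≤ Real.exp c *
      (1 + (S.op (S.op^[p] k) x - c) + q * ∑' α, S.weight α x * S.V (S.branch α x) ^ 3) :=
    hasSum_le (fun α => mul_le_mul_of_nonneg_left (hkey α) (S.weight_nonneg α x))
      (hexpb.summable x).hasSum hsum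
  have h2 : q * ∑' α, S.weight α x * S.V (S.branch α x) ^ 3 ≤ q * M' :=
    mul_le_mul_of_nonneg_left (hMle.trans (le_max_left _ _)) hq0
  have h3 : 1 + (S.op (S.op^[p] k) x - c) + q * ∑' α, S.weight α x * S.V (S.branch α x) ^ 3 ≤
      Real.exp ((S.op (S.op^[p] k) x - c) + q * M') := by
    linarith [Real.add_one_le_exp ((S.op (S.op^[p] k) x - c) + q * M')]
  refine h1.trans ((mul_le_mul_of_nonneg_left h3 (Real.exp_pos c).le).trans_eq ?_)
  rw [← Real.exp_add, hq]
  congr 1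
  ring

lemma measurable_iterate (hS : Y.IsAdapted S) {f : Δ → ℝ} (hf : Measurable f) (m : ℕ) :
    Measurable (S.op^[m] f) := by
  induction m generalizing f with
  | zero => exact hf
  | succ m ih => exact ih (hS.measurable_op hf)

lemma integral_iterate (hS : Y.IsAdapted S) {f : Δ → ℝ} (hf : Measurable f) {M : ℝ}
    (hM : ∀ x, |f x| ≤ M) (m : ℕ) : ∫ x, S.op^[m] f x ∂Y.μ = ∫ x, f x ∂Y.μ := by
  induction m generalizing f with
  | zero => rfl
  | succ m ih =>
    rw [Function.iterate_succ, Function.comp_apply,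
      ih (hS.measurable_op hf) (BranchSystem.abs_iterate_le hM 1), hS.integral_op hf hM]

/-- The iterates of a bounded Lipschitz function converge to its integral. -/
lemma tendsto_iterate (hS : Y.IsAdapted S) {f : Δ → ℝ} (hf : Measurable f) {M L : ℝ}
    (hM : ∀ x, |f x| ≤ M) (hL : ∀ x y, |f x - f y| ≤ L * dist x y) (x : Δ) :
    Filter.Tendsto (fun m => S.op^[m] f x) Filter.atTop (nhds (∫ y, f y ∂Y.μ)) := by
  have := Y.isProbabilityMeasure
  have : Nonempty Δ := ⟨x⟩
  obtain ⟨C, ρ, hC, hρ0, hρ1, hdecay⟩ := BranchSystem.exists_decay hS.minorized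
  have hdec := hdecay f (max M L) (fun x => (hM x).trans (le_max_left _ _)) fun x y _ =>
    (hL x y).trans (mul_le_mul_of_nonneg_right (le_max_right _ _) dist_nonneg)
  have hbd : ∀ m y, |S.op^[m] f y| ≤ M := fun m => BranchSystem.abs_iterate_le hM m
  have hpt : ∀ y, Filter.Tendsto (fun m => S.op^[m] f x - S.op^[m] f y) Filter.atTop (nhds 0) := by
    intro y
    have h1 : Filter.Tendsto (fun m => ρ ^ m * (C * max M L * (S.V x + S.V y))) Filter.atTop
        (nhds 0) := by
      simpa using (tendsto_pow_atTop_nhds_zero_of_lt_one hρ0.le hρ1).mul_const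
        (C * max M L * (S.V x + S.V y))
    refine squeeze_zero_norm (fun m => ?_) h1
    obtain ⟨c, hc⟩ := hdec m
    have h2 := hc y
    rw [abs_sub_comm] at h2
    rw [Real.norm_eq_abs]
    refine (abs_sub_le _ c _).trans ((add_le_add (hc x) h2).trans_eq ?_)
    ring
  have hint : Filter.Tendsto (fun m => ∫ y, (S.op^[m] f x - S.op^[m] f y) ∂Y.μ) Filter.atTop
      (nhds (∫ _, 0 ∂Y.μ)) := by
    refine tendsto_integral_of_dominated_convergence (fun _ => 2 * M)
      (fun m => (measurable_const.sub (hS.measurable_iterate hf m)).aestronglyMeasurable)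
      (integrable_const _) (fun m => .of_forall fun y => ?_) (.of_forall hpt)
    rw [Real.norm_eq_abs]
    refine (abs_sub _ _).trans ?_
    linarith [hbd m x, hbd m y]
  have heq : ∀ m, ∫ y, (S.op^[m] f x - S.op^[m] f y) ∂Y.μ = S.op^[m] f x - ∫ y, f y ∂Y.μ := by
    intro m
    rw [integral_sub (integrable_const _) (Integrable.of_bound
      (hS.measurable_iterate hf m).aestronglyMeasurable M (.of_forall (hbd m))),
      hS.integral_iterate hf hM]
    simp
  simp only [heq, integral_zero] at hint
  simpa using hint.add_const (∫ y, f y ∂Y.μ)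

/-- The concentration inequality when all the Lipschitz constants are small. -/
theorem exists_concentration_of_small (hS : Y.IsAdapted S) :
    ∃ ε₀ C : ℝ, 0 < ε₀ ∧ 0 < C ∧ ∀ (K : (ℕ → Δ) → ℝ) (ℓ : ℕ → ℝ) (n : ℕ),
      (∀ i, 0 ≤ ℓ i) → (∀ i, ℓ i ≤ ε₀) → (∀ i, n ≤ i → ℓ i = 0) → SeqLipschitz K ℓ n →
        ∫ x, Real.exp (K fun i => Y.T^[i] x) ∂Y.μ ≤
          Real.exp (∫ x, K (fun i => Y.T^[i] x) ∂Y.μ) *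
            Real.exp (C * ∑ i ∈ Finset.range n, ℓ i ^ 2) := by
  have := Y.isProbabilityMeasure
  obtain ⟨ε₀, C, ρ, hε₀, hC, hρ0, hρ1, hstep⟩ := hS.exists_step
  have hβ0 := Y.β_pos
  have hβ1 := Y.β_lt_one
  have h1β : 0 < 1 - Y.β := by linarith
  have h1ρ : 0 < 1 - ρ := by linarith
  refine ⟨ε₀, C * (((1 - ρ)⁻¹) ^ 2 * ((1 - Y.β)⁻¹) ^ 2), hε₀, by positivity,
    fun K ℓ n hℓ hℓε hℓn hK => ?_⟩
  obtain ⟨b, hb⟩ := exists_orbit_bound (Y := Y) hℓ hK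
  have hkm : Measurable fun x => K fun i => Y.T^[i] x := (continuous_orbit hℓ hK).measurable
  have hkl := abs_orbit_sub_orbit_le (Y := Y) hℓ hK
  replace hstep := hstep K ℓ n hℓ hℓε hK
  set k : Δ → ℝ := fun x => K fun i => Y.T^[i] x with hk
  set U := geomConv (geomConv ℓ Y.β) ρ with hU
  have hbd : ∀ m y, |S.op^[m] k y| ≤ b := fun m => BranchSystem.abs_iterate_le hb m
  have hem : ∀ m, Measurable fun x => Real.exp (S.op^[m] k x) := fun m =>
    (hS.measurable_iterate hkm m).exp
  have heb : ∀ m x, |Real.exp (S.op^[m] k x)| ≤ Real.exp b := fun m x => by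
    rw [Real.abs_exp, Real.exp_le_exp]
    exact le_of_abs_le (hbd m x)
  have hei : ∀ m, Integrable (fun x => Real.exp (S.op^[m] k x)) Y.μ := fun m =>
    Integrable.of_bound (hem m).aestronglyMeasurable (Real.exp b) (.of_forall (heb m))
  have hsumU : ∀ N, ∑ p ∈ Finset.range N, U p ^ 2 ≤
      ((1 - ρ)⁻¹) ^ 2 * ((1 - Y.β)⁻¹) ^ 2 * ∑ i ∈ Finset.range n, ℓ i ^ 2 := by
    intro N
    have h1 := sum_sq_geomConv_le (geomConv ℓ Y.β) hρ0.le hρ1 N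
    have h2 := sum_sq_geomConv_le ℓ hβ0.le hβ1 N
    have h3 : ∑ i ∈ Finset.range N, ℓ i ^ 2 ≤ ∑ i ∈ Finset.range n, ℓ i ^ 2 := by
      calc _ ≤ ∑ i ∈ Finset.range N ∪ Finset.range n, ℓ i ^ 2 :=
            Finset.sum_le_sum_of_subset_of_nonneg Finset.subset_union_left
              fun i _ _ => sq_nonneg _
        _ = _ := (Finset.sum_subset Finset.subset_union_right fun i _ hi => by
            rw [hℓn i (by simpa using hi)]; norm_num).symm
    rw [mul_assoc]
    refine h1.trans (mul_le_mul_of_nonneg_left (h2.trans ?_) (by positivity))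
    exact mul_le_mul_of_nonneg_left h3 (by positivity)
  have hiter : ∀ N, ∫ x, Real.exp (k x) ∂Y.μ ≤
      Real.exp (C * ∑ p ∈ Finset.range N, U p ^ 2) * ∫ x, Real.exp (S.op^[N] k x) ∂Y.μ := by
    intro N
    induction N with
    | zero => simp
    | succ N ih =>
      refine ih.trans ?_
      rw [Finset.sum_range_succ, mul_add, Real.exp_add, mul_assoc]
      apply mul_le_mul_of_nonneg_left _ (Real.exp_pos _).le
      rw [← hS.integral_op (hem N) (heb N), ← integral_const_mul]
      refine integral_mono (Integrable.of_bound (hS.measurable_op (hem N)).aestronglyMeasurable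
        (Real.exp b) (.of_forall (BranchSystem.abs_iterate_le (heb N) 1)))
        ((hei (N + 1)).const_mul _) fun x => ?_
      refine (hstep N x).trans_eq ?_
      rw [Real.exp_add, mul_comm]
  have hlim : Filter.Tendsto (fun N => ∫ x, Real.exp (S.op^[N] k x) ∂Y.μ) Filter.atTop
      (nhds (Real.exp (∫ x, k x ∂Y.μ))) := by
    have h1 : Filter.Tendsto (fun N => ∫ x, Real.exp (S.op^[N] k x) ∂Y.μ) Filter.atTop
        (nhds (∫ _, Real.exp (∫ x, k x ∂Y.μ) ∂Y.μ)) :=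
      tendsto_integral_of_dominated_convergence (fun _ => Real.exp b)
        (fun N => (hem N).aestronglyMeasurable) (integrable_const _)
        (fun N => .of_forall (heb N)) (.of_forall fun x =>
          (Real.continuous_exp.tendsto _).comp (hS.tendsto_iterate hkm hb hkl x))
    simpa using h1
  rw [mul_comm]
  refine ge_of_tendsto' (hlim.const_mul _) fun N => (hiter N).trans ?_
  have h0 : 0 ≤ ∫ x, Real.exp (S.op^[N] k x) ∂Y.μ := integral_nonneg fun x => (Real.exp_pos _).le
  apply mul_le_mul_of_nonneg_right _ h0
  rw [Real.exp_le_exp, mul_assoc]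
  exact mul_le_mul_of_nonneg_left (hsumU N) hC.le

end IsAdapted

end UniformYoungTower

/-- A separately Lipschitz function is Lipschitz. -/
lemma IsSeparatelyLipschitz.abs_sub_le {X : Type*} [MetricSpace X] {n : ℕ} {K : (Fin n → X) → ℝ}
    {L : Fin n → ℝ≥0} (hK : IsSeparatelyLipschitz K L) (z z' : Fin n → X) :
    |K z - K z'| ≤ ∑ i, (L i : ℝ) * dist (z i) (z' i) := by
  classical
  have key : ∀ s : Finset (Fin n), |K (s.piecewise z z') - K z'| ≤
      ∑ i ∈ s, (L i : ℝ) * dist (z i) (z' i) := by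
    intro s
    induction s using Finset.induction with
    | empty => simp
    | insert a s ha ih =>
      rw [Finset.sum_insert ha, Finset.piecewise_insert]
      have h1 := (hK a (s.piecewise z z')).dist_le_mul (z a) (z' a)
      have h2 : Function.update (s.piecewise z z') a (z' a) = s.piecewise z z' := by
        conv_lhs => rw [← Finset.piecewise_eq_of_notMem s z z' ha]
        exact Function.update_eq_self _ _
      rw [Real.dist_eq, h2] at h1
      exact (_root_.abs_sub_le _ (K (s.piecewise z z')) _).trans (add_le_add h1 ih)
  simpa using key Finset.univ

theorem mainTheorem1 {Δ : Type*} [MetricSpace Δ] [MeasurableSpace Δ] [BorelSpace Δ]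
    {ι : Type*} [Countable ι] (Y : UniformYoungTower Δ ι) (hY : Y.HasExponentialTails) :
    ∃ C : ℝ, 0 < C ∧ ∀ (n : ℕ) (K : (Fin n → Δ) → ℝ) (L : Fin n → ℝ≥0),
      IsSeparatelyLipschitz K L →
        Integrable (fun x => K fun i : Fin n => Y.T^[(i : ℕ)] x) Y.μ ∧
        Integrable (fun x => Real.exp (K fun i : Fin n => Y.T^[(i : ℕ)] x)) Y.μ ∧
        ∫ x, Real.exp (K fun i : Fin n => Y.T^[(i : ℕ)] x) ∂Y.μ ≤
          Real.exp (∫ x, K (fun i : Fin n => Y.T^[(i : ℕ)] x) ∂Y.μ) *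
            Real.exp (C * ∑ i, (L i : ℝ) ^ 2) := by
  classical
  have := Y.isProbabilityMeasure
  obtain ⟨o, -⟩ := Y.base_nonempty
  obtain ⟨S, hS⟩ := UniformYoungTower.exists_isAdapted hY
  obtain ⟨ε₀, C, hε₀, hC, hconc⟩ := hS.exists_concentration_of_small
  refine ⟨C + 2 / ε₀, by positivity, fun n K L hK => ?_⟩
  have hreg : ∀ (K' : (Fin n → Δ) → ℝ) (ℓ : Fin n → ℝ), (∀ i, 0 ≤ ℓ i) →
      (∀ z z', |K' z - K' z'| ≤ ∑ i, ℓ i * dist (z i) (z' i)) →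
      Integrable (fun x => K' fun i : Fin n => Y.T^[(i : ℕ)] x) Y.μ ∧
      Integrable (fun x => Real.exp (K' fun i : Fin n => Y.T^[(i : ℕ)] x)) Y.μ ∧
      ((∀ i, ℓ i ≤ ε₀) → ∫ x, Real.exp (K' fun i : Fin n => Y.T^[(i : ℕ)] x) ∂Y.μ ≤
          Real.exp (∫ x, K' (fun i : Fin n => Y.T^[(i : ℕ)] x) ∂Y.μ) *
            Real.exp (C * ∑ i, ℓ i ^ 2)) := by
    intro K' ℓ hℓ hK'
    set ℓ' : ℕ → ℝ := fun i => if h : i < n then ℓ ⟨i, h⟩ else 0 with hℓ'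
    have hℓ'i : ∀ i : Fin n, ℓ' i = ℓ i := fun i => by simp [hℓ']
    have hℓ'0 : ∀ i, 0 ≤ ℓ' i := fun i => by
      simp only [hℓ']
      split_ifs
      exacts [hℓ _, le_rfl]
    have hK'' : SeqLipschitz (fun z : ℕ → Δ => K' fun i : Fin n => z i) ℓ' n := by
      intro z z'
      refine (hK' _ _).trans_eq ?_
      rw [Finset.sum_range]
      simp only [hℓ'i]
    have hcont := UniformYoungTower.continuous_orbit (Y := Y) hℓ'0 hK''
    obtain ⟨b, hb⟩ := UniformYoungTower.exists_orbit_bound (Y := Y) hℓ'0 hK''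
    refine ⟨Integrable.of_bound hcont.measurable.aestronglyMeasurable b (.of_forall hb),
      Integrable.of_bound hcont.measurable.exp.aestronglyMeasurable (Real.exp b)
        (.of_forall fun x => ?_), fun hsmall => ?_⟩
    · rw [Real.norm_eq_abs, Real.abs_exp, Real.exp_le_exp]
      exact le_of_abs_le (hb x)
    · have h1 := hconc _ ℓ' n hℓ'0 (fun i => by
        simp only [hℓ']
        split_ifs
        exacts [hsmall _, hε₀.le]) (fun i hi => dif_neg (by omega)) hK''
      rw [Finset.sum_range] at h1
      simpa only [hℓ'i] using h1
  have hKl := hK.abs_sub_le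
  obtain ⟨hi1, hi2, -⟩ := hreg K (fun i => L i) (fun i => (L i).2) hKl
  refine ⟨hi1, hi2, ?_⟩
  set F : (Fin n → Δ) → Fin n → Δ := fun z i => if (L i : ℝ) ≤ ε₀ then z i else o with hF
  set s := ∑ i, (L i : ℝ) ^ 2 with hs
  have hKF : ∀ z, |K (F z) - K z| ≤ s / ε₀ := by
    intro z
    refine (hKl _ _).trans ?_
    rw [hs, Finset.sum_div]
    refine Finset.sum_le_sum fun i _ => ?_
    simp only [hF]
    split_ifs with h
    · rw [dist_self, mul_zero]
      positivity
    · rw [le_div_iff₀ hε₀]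
      have h1 : (L i : ℝ) * dist o (z i) ≤ L i := mul_le_of_le_one_right (L i).2 (Y.dist_le_one _ _)
      push Not at h
      have h2 : (0 : ℝ) ≤ L i := (L i).2
      nlinarith
  obtain ⟨hj1, hj2, hj3⟩ := hreg (fun z => K (F z)) (fun i => if (L i : ℝ) ≤ ε₀ then L i else 0)
    (fun i => by split_ifs; exacts [(L i).2, le_rfl]) fun z z' => by
      refine (hKl _ _).trans (Finset.sum_le_sum fun i _ => ?_)
      simp only [hF]
      split_ifs <;> simp
  have h1 := hj3 fun i => by
    split_ifs with h
    exacts [h, hε₀.le]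
  have h2 : ∑ i, (if (L i : ℝ) ≤ ε₀ then (L i : ℝ) else 0) ^ 2 ≤ s :=
    Finset.sum_le_sum fun i _ => by
      split_ifs
      · exact le_rfl
      · rw [zero_pow two_ne_zero]
        positivity
  have h3 : ∫ x, Real.exp (K fun i : Fin n => Y.T^[(i : ℕ)] x) ∂Y.μ ≤
      Real.exp (s / ε₀) * ∫ x, Real.exp (K (F fun i : Fin n => Y.T^[(i : ℕ)] x)) ∂Y.μ := by
    rw [← integral_const_mul]
    refine integral_mono hi2 (hj2.const_mul _) fun x => ?_
    dsimp only
    rw [← Real.exp_add, Real.exp_le_exp]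
    linarith [neg_le_of_abs_le (hKF fun i : Fin n => Y.T^[(i : ℕ)] x)]
  have h4 : ∫ x, K (F fun i : Fin n => Y.T^[(i : ℕ)] x) ∂Y.μ ≤
      ∫ x, K (fun i : Fin n => Y.T^[(i : ℕ)] x) ∂Y.μ + s / ε₀ := by
    have h5 := integral_mono hj1 (hi1.add (integrable_const (s / ε₀))) fun x => by
      have := le_of_abs_le (hKF fun i : Fin n => Y.T^[(i : ℕ)] x)
      simp only [Pi.add_apply]
      linarith
    simpa [integral_add hi1 (integrable_const (s / ε₀))] using h5
  calc _ ≤ _ := h3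
    _ ≤ Real.exp (s / ε₀) * (Real.exp (∫ x, K (fun i : Fin n => Y.T^[(i : ℕ)] x) ∂Y.μ + s / ε₀) *
          Real.exp (C * s)) := by
        refine mul_le_mul_of_nonneg_left (h1.trans ?_) (Real.exp_pos _).le
        gcongr
    _ = _ := by
        rw [← Real.exp_add, ← Real.exp_add, ← Real.exp_add]
        congr 1
        ring
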